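/- Let $k$ be a field, $S=k[x_1,\dots,x_N]$ with the standard grading, and let $\Delta$ be a simplicial complex whose vertices form a subset $V(\Delta)$ of $\{x_1,\dots,x_N\}$. A facet $F$ of $\Delta$ is a leaf if it is the only facet of $\Delta$, or if there is a facet $G\neq F$ with $F\cap H\subseteq G$ for all facets $H\neq F$. A subcollection of $\Delta$ is a simplicial complex all of whose facets are facets of $\Delta$, and $\Delta$ is a simplicial forest if every nonempty subcollection has a leaf. For $u\subseteq V(\Delta)$ let $\Delta_{[u]}$ be the induced subcollection, generated by the facets of $\Delta$ contained in $u$. For a simplicial complex $\Gamma$ with vertices among $x_1,\dots,x_N$, let $\beta_{i,j}(\Gamma)=\beta_{i,j}(S/I)$ be the number of copies of $S(-j)$ in homological degree $i$ of the minimal graded free resolution of $S/I$, where $I=\big(\prod_{x\in F}x : F \text{ a facet of } \Gamma\big)$ is the facet ideal of $\Gamma$. Let $u,w$ be nonempty proper subsets of $V(\Delta)$, each of which is a union of facets of $\Delta$. Call $\Delta_{[u]}$ and $\Delta_{[w]}$ complements in $\Delta$ if $u\cup w=V(\Delta)$ and $\Delta_{[u]}$ and $\Delta_{[w]}$ have no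 facet in common. Theorem. Let $\Delta$ be a simplicial forest with more than one facet and let $n=|V(\Delta)|$. Suppose $\beta_{i,n}(\Delta)\neq 0$ and $i=a+b$ with positive integers $a,b$. Then there are $u,w$ such that $\Delta_{[u]}$ and $\Delta_{[w]}$ are complements in $\Delta$, with $\beta_{a,|u|}(\Delta_{[u]})\neq 0$ and $\beta_{b,|w|}(\Delta_{[w]})\neq 0$. -/

import Mathlib

namespace PreAbstractSimplicialComplex

variable {σ : Type*}

/-- The facets of `Δ`: its faces that are maximal under inclusion. (Mathlib's complexes record only
the nonempty faces.) -/
def facets (Δ : PreAbstractSimplicialComplex σ) : Set (Finset σ) :=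
  {F | Maximal (fun s => s ∈ Δ.faces) F}

/-- The vertex set `V(Δ)`. -/
def vertices (Δ : PreAbstractSimplicialComplex σ) : Set σ :=
  {v | ({v} : Finset σ) ∈ Δ.faces}

/-- The simplicial complex generated by a collection `A` of finite sets. -/
def generatedBy (A : Set (Finset σ)) : PreAbstractSimplicialComplex σ where
  faces := {s | s.Nonempty ∧ ∃ F ∈ A, s ⊆ F}
  isRelLowerSet_faces := fun _ hs =>
    ⟨hs.1, fun _ hts ht => ⟨ht, hs.2.imp fun _ hF => ⟨hF.1, hts.trans hF.2⟩⟩⟩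

/-- `Γ` is a subcollection of `Δ`: every facet of `Γ` is a facet of `Δ`. -/
def IsSubcollection (Γ Δ : PreAbstractSimplicialComplex σ) : Prop :=
  Γ.facets ⊆ Δ.facets

/-- The induced subcollection `Δ_[u]`, generated by the facets of `Δ` contained in `u`. -/
def inducedSubcollection (Δ : PreAbstractSimplicialComplex σ) (u : Finset σ) :
    PreAbstractSimplicialComplex σ :=
  generatedBy {F | F ∈ Δ.facets ∧ F ⊆ u}

/-- A facet `F` is a leaf of `Δ` if it is the only facet, or if there is another facet `G` such
that `F ∩ H ⊆ G` for all facets `H ≠ F`. -/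
def IsLeaf (Δ : PreAbstractSimplicialComplex σ) (F : Finset σ) : Prop :=
  F ∈ Δ.facets ∧
    (Δ.facets = {F} ∨
      ∃ G ∈ Δ.facets, G ≠ F ∧ ∀ H ∈ Δ.facets, H ≠ F → (F ∩ H : Set σ) ⊆ G)

/-- A simplicial forest: every nonempty subcollection has a leaf. -/
def IsForest (Δ : PreAbstractSimplicialComplex σ) : Prop :=
  ∀ Γ : PreAbstractSimplicialComplex σ,
    Γ.IsSubcollection Δ → Γ.facets.Nonempty → ∃ F, Γ.IsLeaf F

/-- `Δ_[u]` and `Δ_[w]` are complements in `Δ`. The first two lines say that the squarefree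
monomials with supports `u` and `w` are elements of the lcm lattice of the facet ideal (that is,
`u` and `w` are unions of facets of `Δ`) other than its bottom `1` and its top. -/
def AreComplements (Δ : PreAbstractSimplicialComplex σ) (u w : Finset σ) : Prop :=
  ((Δ.inducedSubcollection u).vertices = u ∧ u.Nonempty ∧ (u : Set σ) ⊂ Δ.vertices) ∧
  ((Δ.inducedSubcollection w).vertices = w ∧ w.Nonempty ∧ (w : Set σ) ⊂ Δ.vertices) ∧
  (u ∪ w : Set σ) = Δ.vertices ∧
  Disjoint (Δ.inducedSubcollection u).facets (Δ.inducedSubcollection w).facets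

/-- The facet ideal of `Δ` in `k[σ]`, generated by the monomials `∏_{x ∈ F} x`, `F` a facet. -/
noncomputable def facetIdeal (k : Type*) [Field k] (Δ : PreAbstractSimplicialComplex σ) :
    Ideal (MvPolynomial σ k) :=
  Ideal.span ((fun F : Finset σ => ∏ x ∈ F, MvPolynomial.X x) '' Δ.facets)

end PreAbstractSimplicialComplex

/-- A minimal graded free resolution
`⋯ → F₂ → F₁ → F₀ → S/I → 0` of `S/I`, where `S = k[σ]` has its standard grading.
The module `F_i` is free with basis `ι i`, and the basis element `b` has degree `deg i b`, so that
`F_i = ⨁_b S(-deg i b)`. -/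
structure MinimalGradedFreeResolution {σ k : Type*} [Field k] (I : Ideal (MvPolynomial σ k)) where
  /-- the homogeneous basis of `F_i` -/
  ι : ℕ → Type
  finite : ∀ i, Finite (ι i)
  /-- the degrees of the basis elements -/
  deg : ∀ i, ι i → ℕ
  /-- the differential `F_{i+1} → F_i` -/
  d : ∀ i, (ι (i + 1) →₀ MvPolynomial σ k) →ₗ[MvPolynomial σ k] (ι i →₀ MvPolynomial σ k)
  /-- the augmentation `F₀ → S/I` -/
  ε : (ι 0 →₀ MvPolynomial σ k) →ₗ[MvPolynomial σ k] (MvPolynomial σ k ⧸ I)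
  /-- `d` is homogeneous of degree `0`: the `c`-th coordinate of `d b` is homogeneous of degree
  `deg b - deg c` (and zero if this is negative) -/
  d_homogeneous : ∀ i b c, ∀ m ∈ (d i (Finsupp.single b 1) c).support,
    m.degree + deg i c = deg (i + 1) b
  /-- `ε` is homogeneous of degree `0` -/
  ε_homogeneous : ∀ b, ∃ p : MvPolynomial σ k,
    p.IsHomogeneous (deg 0 b) ∧ ε (Finsupp.single b 1) = Ideal.Quotient.mk I p
  ε_surjective : Function.Surjective ε
  exact_zero : Function.Exact (d 0) ε
  exact_succ : ∀ i, Function.Exact (d (i + 1)) (d i)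
  /-- minimality: the image of `d` lies in `𝔪 F_i`, where `𝔪` is the ideal of the variables -/
  minimal : ∀ i x c, MvPolynomial.constantCoeff (d i x c) = 0

open Classical in
/-- The graded Betti number `β_{i,j}(S/I)`: the number of copies of `S(-j)` in homological degree
`i` of the minimal graded free resolution of `S/I`. For a homogeneous ideal in finitely many
variables this resolution exists and is unique up to isomorphism; the value `0` is used for
ideals without such a resolution. -/
noncomputable def gradedBetti {σ k : Type*} [Field k] (I : Ideal (MvPolynomial σ k)) (i j : ℕ) :
    ℕ :=
  if h : Nonempty (MinimalGradedFreeResolution I) then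
    Nat.card {b : h.some.ι i // h.some.deg i b = j}
  else 0

/-- `β_{i,j}(Δ) = β_{i,j}(S/I)` for the facet ideal `I` of `Δ` in `S = k[σ]`. -/
noncomputable def PreAbstractSimplicialComplex.betti {σ : Type*} (k : Type*) [Field k]
    (Δ : PreAbstractSimplicialComplex σ) (i j : ℕ) : ℕ :=
  gradedBetti (Δ.facetIdeal k) i j

/-! Betti numbers of a squarefree monomial ideal can be read off Koszul homology, one multidegree at
a time: in multidegree `W` the Koszul complex of `S/I` has as basis the `T ⊆ W` for which `W \ T`
contains no facet. In internal degree `|V(Δ)|` only the multidegree `V(Δ)` can contribute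
(`hasKoszulHomology_of_not_monomialKoszulExact`), so the task is to split the homological degree of
a nonzero class there.

The splitting (`HasKoszulHomology.exists_complements`) is by induction on `a`. A leaf `F` of an
antichain has a free vertex `v`, lying in no other member. Let `J` be generated by the other
members. Then `S/J` has no homology in multidegrees containing `v`, and `0 → S/(J : x^F)(-F) → S/J →
S/I → 0` matches degree `i + 1` of `I` at `W` with degree `i` of `J : x^F` at `W \ F`
(`contract_iff`). The colon ideal comes from the sets `H \ F`, a family that again has leaves, so
induction splits `W \ F` into `u'` and `w'`. The same matching turns `u'` into `u = u' ∪ F`, one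
homological degree higher. The class at `w'` comes from a class of `J` at some `w` with `w \ F = w'`
(`of_erase_vertices`); since `v ∉ w`, it is also a class of `I`.

The link with resolutions is the symmetry of Tor, obtained by a staircase argument in the double
complex of Koszul complexes of a minimal resolution (`ExactDoubleComplex.vanishesAt_iff`). It
applies to every minimal resolution, so only existence is needed, not uniqueness. -/

/-! ### The Koszul differential and its signs -/

section KoszulDifferential

variable {σ : Type*} [LinearOrder σ]

/-- The sign `(-1)^#{y ∈ T | y < x}` with which `x` is removed from `T ∪ {x}`. -/
def koszulSign (x : σ) (T : Finset σ) : ℤ := (-1) ^ (T.filter (· < x)).card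

theorem koszulSign_mul_self (x : σ) (T : Finset σ) : koszulSign x T * koszulSign x T = 1 := by
  rw [koszulSign, ← mul_pow]; simp

/-- Inserting the smaller of the two vertices adds one to the count for the larger; inserting the
larger does not affect the count for the smaller. -/
theorem koszulSign_anticomm {x y : σ} {T : Finset σ} (hx : x ∉ T) (hy : y ∉ T) (hxy : x ≠ y) :
    koszulSign x T * koszulSign y (insert x T) = -(koszulSign y T * koszulSign x (insert y T)) := by
  have key : ∀ {x y : σ}, x ∉ T → y ∉ T → x < y →
      koszulSign x T * koszulSign y (insert x T) =
        -(koszulSign y T * koszulSign x (insert y T)) := by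
    intro x y hx hy h
    unfold koszulSign
    rw [Finset.filter_insert, if_pos h, Finset.filter_insert, if_neg h.not_gt,
      Finset.card_insert_of_notMem (by simp [hx]), pow_succ]
    ring
  rcases lt_or_gt_of_ne hxy with h | h
  · exact key hx hy h
  · rw [key hy hx h, neg_neg]

variable [Fintype σ] {R M : Type*} [CommRing R] [AddCommGroup M] [Module R M]

/-- The Koszul differential of the sequence `r` with coefficients in `M`; a chain `f` has value
`f T` at the basis element `e_T` of the exterior algebra. -/
def koszulD (r : σ → R) : (Finset σ → M) →ₗ[R] (Finset σ → M) where
  toFun f T := ∑ x ∈ Tᶜ, koszulSign x T • r x • f (insert x T)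
  map_add' f g := by
    ext T; simp [smul_add, Finset.sum_add_distrib]
  map_smul' a f := by
    ext T
    simp only [Pi.smul_apply, RingHom.id_apply, Finset.smul_sum]
    refine Finset.sum_congr rfl fun x _ => ?_
    rw [smul_comm a (koszulSign x T), smul_comm a (r x)]

theorem koszulD_apply (r : σ → R) (f : Finset σ → M) (T : Finset σ) :
    koszulD r f T = ∑ x ∈ Tᶜ, koszulSign x T • r x • f (insert x T) := rfl

theorem koszulD_koszulD (r : σ → R) (f : Finset σ → M) : koszulD r (koszulD r f) = 0 := by
  ext T
  simp only [koszulD_apply, Finset.smul_sum, Pi.zero_apply]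
  rw [Finset.sum_sigma']
  refine Finset.sum_involution (fun p _ => ⟨p.2, p.1⟩) ?_ ?_ ?_ ?_
  · rintro ⟨x, y⟩ h
    simp only [Finset.mem_sigma, Finset.mem_compl, Finset.mem_insert, not_or] at h
    have := koszulSign_anticomm h.1 h.2.2 (Ne.symm h.2.1)
    dsimp only
    rw [Finset.insert_comm y x, smul_comm (r x) (koszulSign y _), smul_comm (r y) (koszulSign x _),
      smul_comm (r x) (r y), smul_smul (koszulSign x T), smul_smul (koszulSign y T), this,
      neg_smul, neg_add_cancel]
  · rintro ⟨x, y⟩ h _ heq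
    simp only [Finset.mem_sigma, Finset.mem_compl, Finset.mem_insert, not_or] at h
    simp only [Sigma.mk.injEq] at heq
    exact h.2.1 heq.1
  · rintro ⟨x, y⟩ h
    simp only [Finset.mem_sigma, Finset.mem_compl, Finset.mem_insert, not_or] at h ⊢
    exact ⟨h.2.2, Ne.symm h.2.1, h.1⟩
  · rintro ⟨x, y⟩ _; rfl

theorem koszulD_map {N : Type*} [AddCommGroup N] [Module R N] (r : σ → R) (φ : M →ₗ[R] N)
    (f : Finset σ → M) (T : Finset σ) :
    koszulD r (fun T => φ (f T)) T = φ (koszulD r f T) := by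
  simp [koszulD_apply, map_sum]

end KoszulDifferential

/-! ### Relative simplicial chains and acyclicity -/

section RelativeChains

variable {σ : Type*} [Fintype σ] [LinearOrder σ] {k : Type*} [Field k]

/-- The boundary map on simplicial chains `c`, indexed by the finite subsets of `σ`. -/
def chainBoundary : (Finset σ → k) →ₗ[k] (Finset σ → k) := koszulD fun _ => (1 : k)

theorem chainBoundary_apply (c : Finset σ → k) (T : Finset σ) :
    chainBoundary c T = ∑ x ∈ Tᶜ, koszulSign x T • c (insert x T) := by
  simp [chainBoundary, koszulD_apply]

/-- The chain complex with basis a set `X` of faces is exact in degree `p`. -/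
def IsAcyclicAt (k : Type*) [Field k] (X : Set (Finset σ)) (p : ℕ) : Prop :=
  ∀ c : Finset σ → k, (∀ T, c T ≠ 0 → T ∈ X ∧ T.card = p) → (∀ T ∈ X, chainBoundary c T = 0) →
    ∃ e : Finset σ → k, (∀ T, e T ≠ 0 → T ∈ X ∧ T.card = p + 1) ∧
      ∀ T ∈ X, chainBoundary e T = c T

theorem chainBoundary_congr {c e : Finset σ → k} {T : Finset σ}
    (h : ∀ x ∉ T, c (insert x T) = e (insert x T)) : chainBoundary c T = chainBoundary e T := by
  rw [chainBoundary_apply, chainBoundary_apply]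
  exact Finset.sum_congr rfl fun x hx => by rw [h x (by simpa using hx)]

theorem exists_of_chainBoundary_ne_zero {c : Finset σ → k} {T : Finset σ}
    (h : chainBoundary c T ≠ 0) : ∃ x ∉ T, c (insert x T) ≠ 0 := by
  by_contra! hc
  exact h ((chainBoundary_congr (e := 0) (by simpa using hc)).trans (by simp))

theorem chainBoundary_eq_zero {c : Finset σ → k} {T : Finset σ}
    (h : ∀ x ∉ T, c (insert x T) = 0) : chainBoundary c T = 0 := by
  by_contra hc
  obtain ⟨x, hx, hcx⟩ := exists_of_chainBoundary_ne_zero hc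
  exact hcx (h x hx)

theorem card_of_chainBoundary_ne_zero {c : Finset σ → k} {p : ℕ}
    (hc : ∀ T, c T ≠ 0 → T.card = p + 1) {T : Finset σ} (h : chainBoundary c T ≠ 0) :
    T.card = p := by
  obtain ⟨x, hx, hcx⟩ := exists_of_chainBoundary_ne_zero h
  have := hc _ hcx
  rw [Finset.card_insert_of_notMem hx] at this
  omega

/-- Order-convexity of `Z` is what makes its chains a complex: any face between `T` and a face of
`c` lies in `Z`, so truncating to `Z` between the two boundaries loses nothing. -/
theorem chainBoundary_indicator_chainBoundary {Z : Set (Finset σ)} (hZ : Z.OrdConnected)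
    {c : Finset σ → k} (hc : ∀ T, c T ≠ 0 → T ∈ Z) {T : Finset σ} (hT : T ∈ Z) :
    chainBoundary (Z.indicator (chainBoundary c)) T = 0 := by
  have h0 : chainBoundary (chainBoundary c) T = 0 := by
    have := koszulD_koszulD (fun _ : σ => (1 : k)) c
    exact congrFun this T
  rw [← h0]
  refine chainBoundary_congr fun x hx => ?_
  by_cases hxZ : insert x T ∈ Z
  · rw [Set.indicator_of_mem hxZ]
  · rw [Set.indicator_of_notMem hxZ]
    refine (chainBoundary_eq_zero fun y hy => ?_).symm
    by_contra hne
    exact hxZ (hZ.out hT (hc _ hne) ⟨Finset.subset_insert _ _, Finset.subset_insert _ _⟩)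

/-- A set of faces that is a cone with apex `x` is acyclic. -/
theorem isAcyclicAt_of_cone {X : Set (Finset σ)} (x : σ)
    (hX : ∀ T, x ∉ T → (T ∈ X ↔ insert x T ∈ X)) (p : ℕ) : IsAcyclicAt k X p := by
  intro c hc hcyc
  -- The contracting homotopy `c ↦ x ∧ c` of the cone.
  refine ⟨fun T => if x ∈ T then koszulSign x (T.erase x) • c (T.erase x) else 0, ?_, ?_⟩
  · intro T hT
    simp only [ne_eq, ite_eq_right_iff, not_forall] at hT
    obtain ⟨hxT, hne⟩ := hT
    have hce : c (T.erase x) ≠ 0 := fun h => hne (by simp [h])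
    obtain ⟨h1, h2⟩ := hc _ hce
    have h3 := (hX _ (Finset.notMem_erase x T)).1 h1
    rw [Finset.insert_erase hxT] at h3
    exact ⟨h3, by rw [← h2, Finset.card_erase_add_one hxT]⟩
  · intro T hT
    rw [chainBoundary_apply]
    by_cases hxT : x ∈ T
    · obtain ⟨U, hU, rfl⟩ : ∃ U, x ∉ U ∧ T = insert x U :=
        ⟨T.erase x, Finset.notMem_erase _ _, (Finset.insert_erase hxT).symm⟩
      have hb := hcyc U ((hX U hU).2 hT)
      rw [chainBoundary_apply, ← Finset.add_sum_erase _ _ (a := x) (by simpa using hU)] at hb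
      have hset : (insert x U)ᶜ = Uᶜ.erase x := by ext; simp
      rw [hset]
      have : ∀ y ∈ Uᶜ.erase x, (koszulSign y (insert x U) •
          if x ∈ insert y (insert x U) then
            koszulSign x ((insert y (insert x U)).erase x) • c ((insert y (insert x U)).erase x)
          else 0) = -(koszulSign x U • koszulSign y U • c (insert y U)) := by
        intro y hy
        simp only [Finset.mem_erase, Finset.mem_compl] at hy
        have hyx : x ∉ insert y U := by simp [hU, Ne.symm hy.1]
        rw [Finset.insert_comm, if_pos (Finset.mem_insert_self _ _), Finset.erase_insert hyx,
          smul_smul, smul_smul]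
        have h1 := koszulSign_anticomm hU hy.2 (Ne.symm hy.1)
        have h2 : koszulSign y (insert x U) * koszulSign x (insert y U) =
            -(koszulSign x U * koszulSign y U) := by
          have e1 := koszulSign_mul_self x U
          have e2 := koszulSign_mul_self x (insert y U)
          calc koszulSign y (insert x U) * koszulSign x (insert y U)
              = koszulSign x U * (koszulSign x U * koszulSign y (insert x U)) *
                  koszulSign x (insert y U) := by
                rw [← mul_assoc, e1, one_mul]
            _ = -(koszulSign x U * koszulSign y U) *
                  (koszulSign x (insert y U) * koszulSign x (insert y U)) := by rw [h1]; ring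
            _ = _ := by rw [e2, mul_one]
        rw [h2, neg_smul]
      rw [Finset.sum_congr rfl this, Finset.sum_neg_distrib, ← Finset.smul_sum,
        eq_neg_of_add_eq_zero_right hb, smul_neg, neg_neg, smul_smul, koszulSign_mul_self, one_smul]
    · rw [Finset.sum_eq_single x]
      · rw [if_pos (Finset.mem_insert_self _ _), Finset.erase_insert hxT, smul_smul,
          koszulSign_mul_self, one_smul]
      · intro y _ hy
        rw [if_neg (by simp [hxT, Ne.symm hy]), smul_zero]
      · intro h; simp [hxT] at h

/-! ### The long exact sequence of a decomposition into a subcomplex and a quotient -/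

section Decomposition

variable {X Y Z : Set (Finset σ)}

/-- By `hup`, `Y` spans a subcomplex of the chains on `Z`, with quotient spanned by `X`. This is the
exact piece `H_{p+1}(Z) → H_{p+1}(X) → H_p(Y)`. -/
theorem IsAcyclicAt.upper (hZ : Z.OrdConnected) (hXYZ : ∀ T, T ∈ Z ↔ T ∈ X ∨ T ∈ Y)
    (hdisj : Disjoint X Y) (hup : ∀ T ∈ X, ∀ x, insert x T ∉ Y) {p : ℕ}
    (hacZ : IsAcyclicAt k Z (p + 1)) (hacY : IsAcyclicAt k Y p) : IsAcyclicAt k X (p + 1) := by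
  intro c hc hcyc
  have hind : Y.indicator (chainBoundary c) = Z.indicator (chainBoundary c) := by
    ext T
    by_cases hTX : T ∈ X
    · rw [Set.indicator_of_notMem (Set.disjoint_left.1 hdisj hTX),
        Set.indicator_of_mem ((hXYZ T).2 (.inl hTX)), hcyc T hTX]
    · by_cases hTY : T ∈ Y
      · rw [Set.indicator_of_mem hTY, Set.indicator_of_mem ((hXYZ T).2 (.inr hTY))]
      · rw [Set.indicator_of_notMem hTY, Set.indicator_of_notMem (by rw [hXYZ]; tauto)]
  -- The part of the boundary of `c` in `Y` represents the connecting map; subtracting its filling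
  -- `g` makes `c - g` a cycle on `Z`.
  obtain ⟨g, hg, hgb⟩ := hacY (Y.indicator (chainBoundary c))
    (fun T hT => by
      have hTY := Set.mem_of_indicator_ne_zero hT
      rw [Set.indicator_of_mem hTY] at hT
      exact ⟨hTY, card_of_chainBoundary_ne_zero (fun T h => (hc T h).2) hT⟩)
    (fun T hT => by
      rw [hind]
      exact chainBoundary_indicator_chainBoundary hZ
        (fun T h => (hXYZ T).2 (.inl (hc T h).1)) ((hXYZ T).2 (.inr hT)))
  obtain ⟨q, hq, hqb⟩ := hacZ (c - g)
    (fun T hT => by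
      by_cases h : c T = 0
      · have : g T ≠ 0 := fun h' => hT (by simp [h, h'])
        exact ⟨(hXYZ T).2 (.inr (hg T this).1), (hg T this).2⟩
      · exact ⟨(hXYZ T).2 (.inl (hc T h).1), (hc T h).2⟩)
    (fun T hT => by
      rw [map_sub, Pi.sub_apply]
      rcases (hXYZ T).1 hT with hTX | hTY
      · rw [hcyc T hTX, zero_sub, neg_eq_zero]
        refine chainBoundary_eq_zero fun x _ => ?_
        by_contra h
        exact hup T hTX x (hg _ h).1
      · rw [hgb T hTY, Set.indicator_of_mem hTY, sub_self])
  refine ⟨X.indicator q, fun T hT => ?_, fun T hT => ?_⟩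
  · have hTX := Set.mem_of_indicator_ne_zero hT
    rw [Set.indicator_of_mem hTX] at hT
    exact ⟨hTX, (hq T hT).2⟩
  · have h1 : chainBoundary (X.indicator q) T = chainBoundary q T := by
      refine chainBoundary_congr fun x _ => ?_
      by_cases h : insert x T ∈ X
      · rw [Set.indicator_of_mem h]
      · rw [Set.indicator_of_notMem h]
        by_contra hne
        rcases (hXYZ _).1 (hq _ (Ne.symm hne)).1 with h' | h'
        · exact h h'
        · exact hup T hT x h'
    have hgT : g T = 0 := by
      by_contra h
      exact Set.disjoint_left.1 hdisj hT (hg T h).1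
    rw [h1, hqb T ((hXYZ T).2 (.inl hT)), Pi.sub_apply, hgT, sub_zero]

/-- The exact piece `H_{p+1}(X) → H_p(Y) → H_p(Z)` of the same sequence. -/
theorem IsAcyclicAt.lower (hZ : Z.OrdConnected) (hXYZ : ∀ T, T ∈ Z ↔ T ∈ X ∨ T ∈ Y)
    (hdisj : Disjoint X Y) (hup : ∀ T ∈ X, ∀ x, insert x T ∉ Y) {p : ℕ}
    (hacZ : IsAcyclicAt k Z p) (hacX : IsAcyclicAt k X (p + 1)) : IsAcyclicAt k Y p := by
  intro c hc hcyc
  have hcX : ∀ T ∈ X, chainBoundary c T = 0 := fun T hT =>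
    chainBoundary_eq_zero fun x _ => by
      by_contra h
      exact hup T hT x (hc _ h).1
  obtain ⟨q, hq, hqb⟩ := hacZ c (fun T h => ⟨(hXYZ T).2 (.inr (hc T h).1), (hc T h).2⟩)
    (fun T hT => ((hXYZ T).1 hT).elim (hcX T) (hcyc T))
  have hqX : ∀ T ∈ X, chainBoundary (X.indicator q) T = chainBoundary q T := by
    intro T hT
    refine chainBoundary_congr fun x _ => ?_
    by_cases h : insert x T ∈ X
    · rw [Set.indicator_of_mem h]
    · rw [Set.indicator_of_notMem h]
      by_contra hne
      rcases (hXYZ _).1 (hq _ (Ne.symm hne)).1 with h' | h'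
      · exact h h'
      · exact hup T hT x h'
  obtain ⟨e, he, heb⟩ := hacX (X.indicator q)
    (fun T hT => by
      have hTX := Set.mem_of_indicator_ne_zero hT
      rw [Set.indicator_of_mem hTX] at hT
      exact ⟨hTX, (hq T hT).2⟩)
    (fun T hT => by
      rw [hqX T hT, hqb T ((hXYZ T).2 (.inl hT))]
      by_contra h
      exact Set.disjoint_left.1 hdisj hT (hc T h).1)
  -- On `X` the boundary of `e` equals `q`, so the difference is supported on `Y` and still bounds
  -- `c` there.
  refine ⟨q - Z.indicator (chainBoundary e), fun T hT => ?_, fun T hT => ?_⟩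
  · have hTZ : T ∈ Z := by
      by_contra h
      refine hT ?_
      rw [Pi.sub_apply, Set.indicator_of_notMem h, sub_zero]
      by_contra h'
      exact h (hq T h').1
    rw [Pi.sub_apply, Set.indicator_of_mem hTZ] at hT
    constructor
    · refine ((hXYZ T).1 hTZ).resolve_left fun hTX => hT ?_
      rw [heb T hTX, Set.indicator_of_mem hTX, sub_self]
    · by_cases h : q T = 0
      · refine card_of_chainBoundary_ne_zero (fun T h => (he T h).2) (T := T) fun h' => hT ?_
        rw [h, h', sub_zero]
      · exact (hq T h).2
  · rw [map_sub, Pi.sub_apply, hqb T ((hXYZ T).2 (.inr hT)),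
      chainBoundary_indicator_chainBoundary hZ (fun T h => (hXYZ T).2 (.inl (he T h).1))
        ((hXYZ T).2 (.inr hT)), sub_zero]

end Decomposition

end RelativeChains

/-! ### Squarefree strands, leaves and the splitting of a homology class -/

section Strands

variable {σ : Type*} [LinearOrder σ]

/-- The subsets `T` of `W` such that `W \ T` contains no member of `𝓕`. They index the basis of
the Koszul complex of `k[σ] / (x^H : H ∈ 𝓕)` in the squarefree multidegree `W`. -/
def strand (𝓕 : Set (Finset σ)) (W : Finset σ) : Set (Finset σ) :=
  {T | T ⊆ W ∧ ∀ H ∈ 𝓕, ¬ H ⊆ W \ T}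

theorem strand_ordConnected (𝓕 : Set (Finset σ)) (W : Finset σ) : (strand 𝓕 W).OrdConnected :=
  ⟨fun _ h₁ _ h₂ _ hT => ⟨hT.2.trans h₂.1, fun H hH hle =>
    h₁.2 H hH (hle.trans (Finset.sdiff_subset_sdiff subset_rfl hT.1))⟩⟩

/-- The strand depends only on which subsets of `W` support monomials of the ideal, not on the
chosen generators. -/
theorem strand_congr {𝓕 𝓖 : Set (Finset σ)} {W : Finset σ}
    (h : ∀ U ⊆ W, (∃ H ∈ 𝓕, H ⊆ U) ↔ ∃ H ∈ 𝓖, H ⊆ U) : strand 𝓕 W = strand 𝓖 W := by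
  ext T
  have := h (W \ T) Finset.sdiff_subset
  simp only [strand, Set.mem_ofPred_eq, and_congr_right_iff]
  intro _
  constructor
  · intro h1 H hH hle
    obtain ⟨H', hH', hle'⟩ := this.2 ⟨H, hH, hle⟩
    exact h1 H' hH' hle'
  · intro h1 H hH hle
    obtain ⟨H', hH', hle'⟩ := this.1 ⟨H, hH, hle⟩
    exact h1 H' hH' hle'

/-- Every nonempty subfamily of `𝓕` has a leaf. -/
def HasLeaves (𝓕 : Set (Finset σ)) : Prop :=
  ∀ 𝓖 ⊆ 𝓕, 𝓖.Nonempty → ∃ L ∈ 𝓖, 𝓖 = {L} ∨ ∃ G ∈ 𝓖, G ≠ L ∧ ∀ H ∈ 𝓖, H ≠ L → L ∩ H ⊆ G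

theorem HasLeaves.mono {𝓕 𝓖 : Set (Finset σ)} (h : HasLeaves 𝓕) (hle : 𝓖 ⊆ 𝓕) : HasLeaves 𝓖 :=
  fun 𝓗 h𝓗 => h 𝓗 (h𝓗.trans hle)

theorem HasLeaves.image_sdiff {𝓕 : Set (Finset σ)} (h : HasLeaves 𝓕) (A : Finset σ) :
    HasLeaves ((· \ A) '' 𝓕) := by
  intro 𝓖 h𝓖 hne
  -- One preimage per member: injectivity keeps the joint `G \ A` distinct from the leaf `L \ A`.
  obtain ⟨𝓗, h𝓗, hbij⟩ := Set.SurjOn.exists_bijOn_subset (f := (· \ A)) (s := 𝓕) (t := 𝓖) h𝓖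
  have himg := hbij.image_eq
  obtain ⟨L, hL, hleaf⟩ := h 𝓗 h𝓗 (Set.image_nonempty.1 (himg ▸ hne))
  refine ⟨L \ A, hbij.mapsTo hL, ?_⟩
  rcases hleaf with rfl | ⟨G, hG, hGL, hint⟩
  · left; rw [← himg, Set.image_singleton]
  · refine .inr ⟨G \ A, hbij.mapsTo hG, fun e => hGL (hbij.injOn hG hL e), ?_⟩
    rw [← himg]
    rintro _ ⟨H, hH, rfl⟩ hHL y hy
    simp only [Finset.mem_inter, Finset.mem_sdiff] at hy ⊢
    exact ⟨hint H hH (fun e => hHL (by rw [e])) (Finset.mem_inter.2 ⟨hy.1.1, hy.2.1⟩), hy.1.2⟩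

variable [Fintype σ] {k : Type*} [Field k]

variable (k) in
/-- The Koszul homology of `k[σ] / (x^H : H ∈ 𝓕)` in homological degree `i` and multidegree `W`
is not zero. -/
def HasKoszulHomology (𝓕 : Set (Finset σ)) (W : Finset σ) (i : ℕ) : Prop :=
  ¬ IsAcyclicAt k (strand 𝓕 W) i

namespace HasKoszulHomology

/-- Were `x` in no member inside `W`, adding or removing `x` would not affect membership in the
strand, which would be a cone. -/
theorem exists_mem {𝓕 : Set (Finset σ)} {W : Finset σ} {i : ℕ} (h : HasKoszulHomology k 𝓕 W i)
    {x : σ} (hx : x ∈ W) : ∃ H ∈ 𝓕, H ⊆ W ∧ x ∈ H := by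
  by_contra! hc
  refine h (isAcyclicAt_of_cone x (fun T _ => and_congr ?_ ?_) i)
  · simp [Finset.insert_subset_iff, hx]
  · refine forall₂_congr fun H hH => not_congr ?_
    constructor
    · intro hle y hy
      have h1 := Finset.mem_sdiff.1 (hle hy)
      refine Finset.mem_sdiff.2 ⟨h1.1, fun h2 => ?_⟩
      rcases Finset.mem_insert.1 h2 with rfl | h2
      · exact hc H hH (hle.trans Finset.sdiff_subset) hy
      · exact h1.2 h2
    · exact fun hle => hle.trans (Finset.sdiff_subset_sdiff subset_rfl (Finset.subset_insert _ _))

theorem strand_nonempty {𝓕 : Set (Finset σ)} {W : Finset σ} {i : ℕ}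
    (h : HasKoszulHomology k 𝓕 W i) : (strand 𝓕 W).Nonempty := by
  by_contra hc
  rw [Set.not_nonempty_iff_eq_empty] at hc
  refine h fun c hcs _ => ⟨0, by simp, ?_⟩
  simp [hc]

theorem empty_notMem {𝓕 : Set (Finset σ)} {W : Finset σ} {i : ℕ}
    (h : HasKoszulHomology k 𝓕 W i) : ∅ ∉ 𝓕 := fun hm => by
  obtain ⟨T, hT⟩ := h.strand_nonempty
  exact hT.2 ∅ hm (Finset.empty_subset _)

theorem nonempty {𝓕 : Set (Finset σ)} {W : Finset σ} {i : ℕ}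
    (h : HasKoszulHomology k 𝓕 W i) (hi : 0 < i) : W.Nonempty := by
  by_contra hW
  rw [Finset.not_nonempty_iff_eq_empty] at hW
  subst hW
  refine h fun c hcs _ => ⟨0, by simp, fun T hT => ?_⟩
  rw [map_zero, Pi.zero_apply]
  by_contra hne
  obtain ⟨h1, h2⟩ := hcs T (Ne.symm hne)
  have := Finset.subset_empty.1 h1.1
  subst this
  simp at h2
  omega

theorem of_empty {𝓕 : Set (Finset σ)} (h : ∅ ∉ 𝓕) : HasKoszulHomology k 𝓕 ∅ 0 := by
  intro hac
  obtain ⟨e, he, heb⟩ := hac (fun T => if T = ∅ then 1 else 0)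
    (fun T hT => by
      have : T = ∅ := by by_contra h; simp [h] at hT
      subst this
      exact ⟨⟨subset_rfl, fun H hH hle => h (by
        rwa [Finset.subset_empty.1 (hle.trans Finset.sdiff_subset)] at hH)⟩, rfl⟩)
    (fun T _ => chainBoundary_eq_zero fun x _ => by simp)
  have hm : (∅ : Finset σ) ∈ strand 𝓕 ∅ := ⟨subset_rfl, fun H hH hle => h (by
        rwa [Finset.subset_empty.1 (hle.trans Finset.sdiff_subset)] at hH)⟩
  have h1 := heb ∅ hm
  rw [chainBoundary_eq_zero] at h1
  · simp at h1
  · intro x _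
    by_contra hne
    simpa using (he _ hne).1.1

/-- The strand of `𝓙` at `W` is a cone with apex the free vertex `v`. Its faces `T` with `F ⊆ W \ T`
form the strand of the contracted family at `W \ F`, and the others form the strand of `insert F 𝓙`;
the connecting map between the two homologies is therefore an isomorphism. -/
theorem contract_iff {𝓙 : Set (Finset σ)} {F W : Finset σ} {v : σ} (hv : v ∈ F) (hFW : F ⊆ W)
    (hfree : ∀ H ∈ 𝓙, v ∉ H) (i : ℕ) :
    HasKoszulHomology k (insert F 𝓙) W (i + 1) ↔
      HasKoszulHomology k ((· \ F) '' 𝓙) (W \ F) i := by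
  have hcone : ∀ p, IsAcyclicAt k (strand 𝓙 W) p := fun p => by
    by_contra h
    obtain ⟨H, hH, -, hvH⟩ := exists_mem (k := k) h (hFW hv)
    exact hfree H hH hvH
  have hF : ∀ {T : Finset σ}, T ⊆ W → (F ⊆ W \ T ↔ T ⊆ W \ F) := by
    intro T hT
    constructor <;> intro h y hy
    · exact Finset.mem_sdiff.2 ⟨hT hy, fun hyF => (Finset.mem_sdiff.1 (h hyF)).2 hy⟩
    · exact Finset.mem_sdiff.2 ⟨hFW hy, fun hyT => (Finset.mem_sdiff.1 (h hyT)).2 hy⟩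
  have hY : ∀ T, T ∈ strand ((· \ F) '' 𝓙) (W \ F) ↔ T ∈ strand 𝓙 W ∧ F ⊆ W \ T := by
    intro T
    simp only [strand, Set.mem_ofPred_eq, Set.forall_mem_image]
    constructor
    · rintro ⟨h1, h2⟩
      have hTW := h1.trans Finset.sdiff_subset
      refine ⟨⟨hTW, fun H hH hle => h2 hH ?_⟩, (hF hTW).2 h1⟩
      rw [sdiff_right_comm]
      exact Finset.sdiff_subset_sdiff hle subset_rfl
    · rintro ⟨⟨h1, h2⟩, h3⟩
      refine ⟨(hF h1).1 h3, fun H hH hle => h2 H hH fun y hy => ?_⟩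
      by_cases hyF : y ∈ F
      · exact h3 hyF
      · have := hle (Finset.mem_sdiff.2 ⟨hy, hyF⟩)
        simp only [Finset.mem_sdiff] at this ⊢
        tauto
  have hX : ∀ T, T ∈ strand (insert F 𝓙) W ↔ T ∈ strand 𝓙 W ∧ ¬ F ⊆ W \ T := by
    intro T
    simp only [strand, Set.mem_ofPred_eq, Set.forall_mem_insert]
    tauto
  have hXYZ : ∀ T, T ∈ strand 𝓙 W ↔
      T ∈ strand (insert F 𝓙) W ∨ T ∈ strand ((· \ F) '' 𝓙) (W \ F) := by
    intro T; rw [hX, hY]; tauto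
  have hdisj : Disjoint (strand (insert F 𝓙) W) (strand ((· \ F) '' 𝓙) (W \ F)) :=
    Set.disjoint_left.2 fun T h1 h2 => ((hX T).1 h1).2 ((hY T).1 h2).2
  have hup : ∀ T ∈ strand (insert F 𝓙) W, ∀ x, insert x T ∉ strand ((· \ F) '' 𝓙) (W \ F) :=
    fun T h1 x h2 => ((hX T).1 h1).2 (((hY _).1 h2).2.trans
      (Finset.sdiff_subset_sdiff subset_rfl (Finset.subset_insert _ _)))
  exact not_congr ⟨IsAcyclicAt.lower (strand_ordConnected 𝓙 W) hXYZ hdisj hup (hcone i),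
    IsAcyclicAt.upper (strand_ordConnected 𝓙 W) hXYZ hdisj hup (hcone (i + 1))⟩

/-- Erasing `x` from the generators is taking the colon by `x`. In the strand of `𝓙` at `insert x
W`, the faces without `x` form the strand of the colon at `W`, and those with `x` are a copy of the
strand of `𝓙` at `W`, shifted by one. -/
theorem of_erase_vertex {𝓙 : Set (Finset σ)} {W : Finset σ} {x : σ} (hx : x ∉ W) {i : ℕ}
    (h : HasKoszulHomology k ((· \ {x}) '' 𝓙) W i) :
    HasKoszulHomology k 𝓙 W i ∨ HasKoszulHomology k 𝓙 (insert x W) i := by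
  by_contra! hc
  simp only [HasKoszulHomology, not_not] at hc
  obtain ⟨hc1, hc2⟩ := hc
  refine h ?_
  -- the faces of `strand 𝓙 (insert x W)` containing `x`
  set A : Set (Finset σ) := {T | x ∈ T ∧ T ∈ strand 𝓙 (insert x W)} with hA
  have hins : ∀ T, x ∉ T → (insert x T ∈ strand 𝓙 (insert x W) ↔ T ∈ strand 𝓙 W) := by
    intro T hT
    have h1 : insert x W \ insert x T = W \ T := by
      ext y; simp only [Finset.mem_sdiff, Finset.mem_insert]
      constructor
      · tauto
      · rintro ⟨h1, h2⟩
        refine ⟨.inr h1, ?_⟩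
        rintro (rfl | h3)
        · exact hx h1
        · exact h2 h3
    simp only [strand, Set.mem_ofPred_eq, h1, Finset.insert_subset_iff, Finset.mem_insert_self,
      true_and]
    refine and_congr_left fun _ => ⟨fun h y hy => ?_, fun h => h.trans (Finset.subset_insert _ _)⟩
    exact Finset.mem_of_mem_insert_of_ne (h hy) (fun e => hT (e ▸ hy))
  have hxs : ∀ T ∈ strand 𝓙 W, x ∉ T := fun T hT h => hx (hT.1 h)
  have hacA : IsAcyclicAt k A (i + 1) := by
    -- `A ∪ strand 𝓙 W` is a cone with apex `x`, which carries acyclicity of `strand 𝓙 W` in degree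
    -- `i` to `A` in degree `i + 1`.
    refine IsAcyclicAt.upper (Y := strand 𝓙 W) (Z := A ∪ strand 𝓙 W) ?_ (fun T => Iff.rfl) ?_ ?_
      (isAcyclicAt_of_cone x ?_ _) hc1
    · refine ⟨?_⟩
      rintro T₁ h₁ T₂ h₂ T ⟨hT₁ : T₁ ⊆ T, hT₂ : T ⊆ T₂⟩
      have key : ∀ T, T ∈ A ∪ strand 𝓙 W ↔ insert x T ∈ strand 𝓙 (insert x W) := by
        intro T
        by_cases hxT : x ∈ T
        · rw [Finset.insert_eq_of_mem hxT]
          exact ⟨fun h => h.elim And.right fun h => (hxs T h hxT).elim, fun h => .inl ⟨hxT, h⟩⟩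
        · rw [hins T hxT]
          exact ⟨fun h => h.elim (fun h => (hxT h.1).elim) id, .inr⟩
      rw [key] at h₁ h₂ ⊢
      exact (strand_ordConnected _ _).out h₁ h₂
        ⟨Finset.insert_subset_insert _ hT₁, Finset.insert_subset_insert _ hT₂⟩
    · exact Set.disjoint_left.2 fun T h1 h2 => hxs T h2 h1.1
    · exact fun T h1 y h2 => hxs _ h2 (Finset.mem_insert_of_mem h1.1)
    · intro T hT
      constructor
      · rintro (h | h)
        · exact (hT h.1).elim
        · exact .inl ⟨Finset.mem_insert_self _ _, (hins T hT).2 h⟩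
      · rintro (h | h)
        · exact .inr ((hins T hT).1 h.2)
        · exact (hxs _ h (Finset.mem_insert_self _ _)).elim
  have hY : ∀ T, T ∈ strand ((· \ {x}) '' 𝓙) W ↔ x ∉ T ∧ T ∈ strand 𝓙 (insert x W) := by
    intro T
    simp only [strand, Set.mem_ofPred_eq, Set.forall_mem_image]
    constructor
    · rintro ⟨h1, h2⟩
      refine ⟨fun h => hx (h1 h), h1.trans (Finset.subset_insert _ _), fun H hH hle => h2 hH ?_⟩
      intro y hy
      simp only [Finset.mem_sdiff, Finset.mem_singleton] at hy
      have := hle hy.1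
      simp only [Finset.mem_sdiff, Finset.mem_insert] at this ⊢
      tauto
    · rintro ⟨h0, h1, h2⟩
      refine ⟨fun y hy => Finset.mem_of_mem_insert_of_ne (h1 hy) (fun e => h0 (e ▸ hy)),
        fun H hH hle => h2 H hH fun y hy => ?_⟩
      by_cases hyx : y = x
      · subst hyx; simp [h0]
      · have := hle (Finset.mem_sdiff.2 ⟨hy, by simpa using hyx⟩)
        simp only [Finset.mem_sdiff, Finset.mem_insert] at this ⊢
        tauto
  refine IsAcyclicAt.lower (X := A) (strand_ordConnected 𝓙 (insert x W)) (fun T => ?_) ?_ ?_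
    hc2 hacA
  · rw [hY, hA, Set.mem_ofPred_eq]; tauto
  · exact Set.disjoint_left.2 fun T h1 h2 => ((hY T).1 h2).1 h1.1
  · exact fun T h1 y h2 => ((hY _).1 h2).1 (Finset.mem_insert_of_mem h1.1)

/-- Restoring the vertices of `A` one at a time, each may or may not enter the multidegree; hence
`w` is only determined outside `A`. -/
theorem of_erase_vertices {𝓙 : Set (Finset σ)} {W A : Finset σ} (hWA : Disjoint W A) {i : ℕ}
    (h : HasKoszulHomology k ((· \ A) '' 𝓙) W i) :
    ∃ w, w \ A = W ∧ HasKoszulHomology k 𝓙 w i := by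
  induction A using Finset.induction_on generalizing W with
  | empty => exact ⟨W, by simp, by simpa using h⟩
  | insert x A hxA ih =>
    rw [Finset.disjoint_insert_right] at hWA
    have himg : (· \ insert x A) '' 𝓙 = (· \ {x}) '' ((· \ A) '' 𝓙) := by
      rw [Set.image_image]
      refine Set.image_congr fun H _ => ?_
      rw [sdiff_sdiff, Finset.insert_eq, Finset.union_comm, Finset.sup_eq_union]
    rw [himg] at h
    rcases of_erase_vertex hWA.1 h with h | h
    · obtain ⟨w, hw, hN⟩ := ih hWA.2 h
      refine ⟨w, ?_, hN⟩
      rw [Finset.sdiff_insert, hw, Finset.erase_eq_of_notMem hWA.1]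
    · obtain ⟨w, hw, hN⟩ := ih (Finset.disjoint_insert_left.2 ⟨hxA, hWA.2⟩) h
      refine ⟨w, ?_, hN⟩
      rw [Finset.sdiff_insert, hw, Finset.erase_insert hWA.1]

end HasKoszulHomology

/-- In a family all of whose subfamilies have leaves, a nonzero Koszul homology class of
homological degree `a + b` splits over two complementary multidegrees. -/
theorem HasKoszulHomology.exists_complements (a b : ℕ) {𝓕 : Set (Finset σ)} (hleaf : HasLeaves 𝓕)
    {W : Finset σ} (h : HasKoszulHomology k 𝓕 W (a + b)) :
    ∃ u w : Finset σ, u ∪ w = W ∧ HasKoszulHomology k 𝓕 u a ∧ HasKoszulHomology k 𝓕 w b ∧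
      ∀ H ∈ 𝓕, ¬ H ⊆ u ∩ w := by
  induction a generalizing 𝓕 W with
  | zero =>
    rw [zero_add] at h
    refine ⟨∅, W, Finset.empty_union W, .of_empty h.empty_notMem, h, fun H hH hle => ?_⟩
    rw [Finset.empty_inter, Finset.subset_empty] at hle
    exact h.empty_notMem (hle ▸ hH)
  | succ a ih =>
    -- Contraction can destroy the antichain property, so each step first returns to the minimal
    -- members, which generate the same ideal.
    set 𝓜 : Set (Finset σ) := {H | Minimal (· ∈ 𝓕) H} with h𝓜
    have hsub : 𝓜 ⊆ 𝓕 := fun H hH => hH.1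
    have hmin : ∀ H ∈ 𝓕, ∃ H' ∈ 𝓜, H' ⊆ H := fun H hH => by
      obtain ⟨H', hle, hH'⟩ := (Set.toFinite 𝓕).exists_le_minimal hH
      exact ⟨H', hH', hle⟩
    have hstrand : ∀ U, strand 𝓜 U = strand 𝓕 U := fun U => strand_congr fun U' _ =>
      ⟨fun ⟨H, hH, hle⟩ => ⟨H, hsub hH, hle⟩, fun ⟨H, hH, hle⟩ =>
        let ⟨H', hH', hle'⟩ := hmin H hH; ⟨H', hH', hle'.trans hle⟩⟩
    have hN : ∀ U p, HasKoszulHomology k 𝓜 U p ↔ HasKoszulHomology k 𝓕 U p := fun U p => by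
      rw [HasKoszulHomology, HasKoszulHomology, hstrand]
    -- minimal members inside `W`
    set 𝓜W : Set (Finset σ) := {H | H ∈ 𝓜 ∧ H ⊆ W} with h𝓜W
    have hNW : ∀ U ⊆ W, ∀ p, HasKoszulHomology k 𝓜W U p ↔ HasKoszulHomology k 𝓕 U p := by
      intro U hU p
      rw [← hN, HasKoszulHomology, HasKoszulHomology, strand_congr]
      exact fun U' hU' => ⟨fun ⟨H, hH, hle⟩ => ⟨H, hH.1, hle⟩,
        fun ⟨H, hH, hle⟩ => ⟨H, ⟨hH, (hle.trans hU').trans hU⟩, hle⟩⟩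
    obtain ⟨x, hx⟩ := h.nonempty (by omega)
    have hW := (hNW W subset_rfl _).2 h
    obtain ⟨H₀, hH₀, -, -⟩ := hW.exists_mem hx
    obtain ⟨F, hF, hFleaf⟩ := hleaf 𝓜W (fun H hH => hsub hH.1) ⟨H₀, hH₀⟩
    have hanti : ∀ G ∈ 𝓜W, G ≠ F → ¬ F ⊆ G := fun G hG hne hle =>
      hne (Finset.Subset.antisymm (hG.1.2 (hsub hF.1) hle) hle)
    -- In an antichain `F` is not contained in its joint `G`, and any point of `F` outside `G` is
    -- free.
    obtain ⟨v, hvF, hv⟩ : ∃ v ∈ F, ∀ H ∈ 𝓜W, H ≠ F → v ∉ H := by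
      rcases hFleaf with hs | ⟨G, hG, hGF, hint⟩
      · have hFne : F.Nonempty := by
          rw [Finset.nonempty_iff_ne_empty]
          rintro rfl
          exact hW.empty_notMem hF
        obtain ⟨v, hv⟩ := hFne
        exact ⟨v, hv, fun H hH hne => (hne (by rw [hs] at hH; exact hH)).elim⟩
      · obtain ⟨v, hvF, hvG⟩ := Finset.not_subset.1 (hanti G hG hGF)
        exact ⟨v, hvF, fun H hH hne hvH => hvG (hint H hH hne (Finset.mem_inter.2 ⟨hvF, hvH⟩))⟩
    set 𝓙 : Set (Finset σ) := 𝓜W \ {F} with h𝓙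
    have hins : insert F 𝓙 = 𝓜W := by rw [h𝓙, Set.insert_sdiff_singleton, Set.insert_eq_of_mem hF]
    have hfree : ∀ H ∈ 𝓙, v ∉ H := fun H hH => hv H hH.1 hH.2
    rw [← hins, Nat.add_right_comm, HasKoszulHomology.contract_iff hvF hF.2 hfree] at hW
    obtain ⟨u', w', hunion, hu', hw', hdis⟩ := ih
      ((hleaf.mono (fun H hH => hsub hH.1.1)).image_sdiff F) hW
    have hu'W : u' ⊆ W \ F := hunion ▸ Finset.subset_union_left
    have hw'W : w' ⊆ W \ F := hunion ▸ Finset.subset_union_right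
    have hu'F : Disjoint u' F := Finset.disjoint_of_subset_left hu'W Finset.sdiff_disjoint
    -- This class belongs to `𝓙`; it is one of `𝓜W` too because `v ∉ w` rules out `F ⊆ w`.
    obtain ⟨w, hw, hNw⟩ := hw'.of_erase_vertices
      (Finset.disjoint_of_subset_left hw'W Finset.sdiff_disjoint)
    have hvw : v ∉ w := fun hvw => by
      obtain ⟨H, hH, -, hvH⟩ := hNw.exists_mem hvw
      exact hfree H hH hvH
    have hwW : w ⊆ W := fun y hy => by
      by_cases hyF : y ∈ F
      · exact hF.2 hyF
      · exact (Finset.mem_sdiff.1 (hw'W (hw ▸ Finset.mem_sdiff.2 ⟨hy, hyF⟩))).1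
    have huW : u' ∪ F ⊆ W := Finset.union_subset (hu'W.trans Finset.sdiff_subset) hF.2
    refine ⟨u' ∪ F, w, ?_, ?_, ?_, ?_⟩
    · refine Finset.Subset.antisymm (Finset.union_subset huW hwW) fun y hy => ?_
      by_cases hyF : y ∈ F
      · simp [hyF]
      · have : y ∈ u' ∪ w' := by rw [hunion]; exact Finset.mem_sdiff.2 ⟨hy, hyF⟩
        rcases Finset.mem_union.1 this with h1 | h1
        · simp [h1]
        · rw [← hw] at h1
          simp [(Finset.mem_sdiff.1 h1).1]
    · rw [← hNW _ huW, ← hins, HasKoszulHomology.contract_iff hvF Finset.subset_union_right hfree,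
        Finset.union_sdiff_right, Finset.sdiff_eq_self_of_disjoint hu'F]
      exact hu'
    · rw [← hNW _ hwW, ← hins, HasKoszulHomology, strand_congr (𝓖 := 𝓙)]
      · exact hNw
      · intro U hU
        refine ⟨?_, fun ⟨H, hH, hle⟩ => ⟨H, Set.mem_insert_of_mem _ hH, hle⟩⟩
        rintro ⟨H, rfl | hH, hle⟩
        · exact (hvw (hU (hle hvF))).elim
        · exact ⟨H, hH, hle⟩
    · intro H hH hle
      obtain ⟨H', hH', hle'⟩ := hmin H hH
      have hle'' := hle'.trans hle
      have hH'W : H' ∈ 𝓜W := ⟨hH', hle''.trans (Finset.inter_subset_right.trans hwW)⟩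
      by_cases hH'F : H' = F
      · subst hH'F
        exact hvw (Finset.mem_inter.1 (hle'' hvF)).2
      -- Outside `F` the sets `u' ∪ F` and `w` agree with `u'` and `w'`, which share no member of
      -- the contracted family.
      · refine hdis (H' \ F) ⟨H', ⟨hH'W, hH'F⟩, rfl⟩ fun y hy => ?_
        have hy' := Finset.mem_sdiff.1 hy
        have := Finset.mem_inter.1 (hle'' hy'.1)
        refine Finset.mem_inter.2 ⟨(Finset.mem_union.1 this.1).resolve_right hy'.2, ?_⟩
        rw [← hw]
        exact Finset.mem_sdiff.2 ⟨this.2, hy'.2⟩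

end Strands

/-! ### The Koszul complex of a monomial quotient, by multidegree -/

section MonomialKoszul

open MvPolynomial

variable {σ : Type*}

/-- The exponent of the squarefree monomial with support `T`. -/
noncomputable def faceExponent (T : Finset σ) : σ →₀ ℕ := ∑ x ∈ T, Finsupp.single x 1

theorem degree_faceExponent (T : Finset σ) : (faceExponent T).degree = T.card := by
  simp [faceExponent, map_sum]

theorem prod_X_eq_monomial {k : Type*} [Field k] (T : Finset σ) :
    ∏ x ∈ T, (X x : MvPolynomial σ k) = monomial (faceExponent T) 1 := by
  rw [faceExponent, monomial_sum_one]
  rfl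

/-- Exponents of the monomials in the ideal generated by the squarefree monomials with supports
in `𝓕`. -/
def SquarefreeExponent (𝓕 : Set (Finset σ)) (m : σ →₀ ℕ) : Prop := ∃ F ∈ 𝓕, F ⊆ m.support

theorem SquarefreeExponent.mono {𝓕 : Set (Finset σ)} (a b : σ →₀ ℕ) (hab : a ≤ b)
    (h : SquarefreeExponent 𝓕 a) : SquarefreeExponent 𝓕 b :=
  h.imp fun _ hF => ⟨hF.1, hF.2.trans (Finsupp.support_mono hab)⟩

variable [LinearOrder σ]

theorem faceExponent_apply (T : Finset σ) (x : σ) :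
    faceExponent T x = if x ∈ T then 1 else 0 := by
  simp [faceExponent, Finsupp.finsetSum_apply, Finsupp.single_apply]

theorem support_faceExponent (T : Finset σ) : (faceExponent T).support = T := by
  ext x; simp [faceExponent_apply]

theorem faceExponent_le_iff {T : Finset σ} {m : σ →₀ ℕ} :
    faceExponent T ≤ m ↔ T ⊆ m.support := by
  rw [Finsupp.le_def]
  constructor
  · intro h x hx
    have := h x
    rw [faceExponent_apply, if_pos hx] at this
    rw [Finsupp.mem_support_iff]; omega
  · intro h x
    rw [faceExponent_apply]
    split_ifs with hx
    · exact Nat.one_le_iff_ne_zero.2 (Finsupp.mem_support_iff.1 (h hx))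
    · exact Nat.zero_le _

theorem faceExponent_insert {T : Finset σ} {x : σ} (hx : x ∉ T) :
    faceExponent (insert x T) = faceExponent T + Finsupp.single x 1 := by
  rw [faceExponent, Finset.sum_insert hx, add_comm, faceExponent]

variable {k : Type*} [Field k]

/-- The Koszul chains over `k[σ]` of homological degree `p` and internal degree `j`. -/
def IsKoszulChain (p j : ℕ) (f : Finset σ → MvPolynomial σ k) : Prop :=
  ∀ T m, coeff m (f T) ≠ 0 → T.card = p ∧ m.degree + T.card = j

/-- The basis of the Koszul complex in multidegree `m`. -/
def multidegreeFaces (P : (σ →₀ ℕ) → Prop) (m : σ →₀ ℕ) : Set (Finset σ) :=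
  {T | T ⊆ m.support ∧ ¬ P (m - faceExponent T)}

/-- The component of a Koszul chain in multidegree `m`. -/
noncomputable def multidegreeComponent (m : σ →₀ ℕ) (f : Finset σ → MvPolynomial σ k) :
    Finset σ → k :=
  fun T => if T ⊆ m.support then coeff (m - faceExponent T) (f T) else 0

theorem multidegreeFaces_faceExponent (𝓕 : Set (Finset σ)) (W : Finset σ) :
    multidegreeFaces (SquarefreeExponent 𝓕) (faceExponent W) = strand 𝓕 W := by
  ext T
  have h : (faceExponent W - faceExponent T).support = W \ T := by
    ext x
    simp only [Finsupp.mem_support_iff, Finsupp.tsub_apply, faceExponent_apply, Finset.mem_sdiff]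
    split_ifs <;> simp_all
  simp [multidegreeFaces, strand, SquarefreeExponent, h, support_faceExponent]

theorem coeff_eq_multidegreeComponent (f : Finset σ → MvPolynomial σ k) (T : Finset σ)
    (a : σ →₀ ℕ) : coeff a (f T) = multidegreeComponent (a + faceExponent T) f T := by
  rw [multidegreeComponent, if_pos (faceExponent_le_iff.1 le_add_self), add_tsub_cancel_right]

variable [Fintype σ]

variable (k) in
/-- Exactness, in homological degree `p` and internal degree `j`, of the Koszul complex of the
quotient of `k[σ]` by the ideal spanned by the monomials with exponents in `P`. -/
def MonomialKoszulExact (P : (σ →₀ ℕ) → Prop) (p j : ℕ) : Prop :=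
  ∀ f : Finset σ → MvPolynomial σ k, IsKoszulChain p j f →
    (∀ T m, ¬ P m → coeff m (koszulD (X (R := k)) f T) = 0) →
    ∃ g : Finset σ → MvPolynomial σ k, IsKoszulChain (p + 1) j g ∧
      ∀ T m, ¬ P m → coeff m (f T) = coeff m (koszulD (X (R := k)) g T)

theorem coeff_koszulD (f : Finset σ → MvPolynomial σ k) (T : Finset σ) (m : σ →₀ ℕ) :
    coeff m (koszulD (X (R := k)) f T) = ∑ x ∈ Tᶜ, koszulSign x T •
      (if x ∈ m.support then coeff (m - Finsupp.single x 1) (f (insert x T)) else 0) := by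
  rw [koszulD_apply, coeff_sum]
  refine Finset.sum_congr rfl fun x _ => ?_
  rw [← coeff_X_mul', smul_eq_mul, ← lcoeff_apply, map_zsmul, lcoeff_apply]

theorem chainBoundary_multidegreeComponent {m : σ →₀ ℕ} (f : Finset σ → MvPolynomial σ k)
    {T : Finset σ} (hT : T ⊆ m.support) :
    chainBoundary (multidegreeComponent m f) T = coeff (m - faceExponent T) (koszulD (X (R := k)) f T) := by
  rw [coeff_koszulD, chainBoundary_apply]
  refine Finset.sum_congr rfl fun x hx => ?_
  have hxT : x ∉ T := by simpa using hx
  have h1 : insert x T ⊆ m.support ↔ x ∈ (m - faceExponent T).support := by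
    rw [Finset.insert_subset_iff, Finsupp.mem_support_iff, Finsupp.mem_support_iff,
      Finsupp.tsub_apply, faceExponent_apply, if_neg hxT, Nat.sub_zero]
    exact and_iff_left hT
  simp only [multidegreeComponent, h1, faceExponent_insert hxT, tsub_add_eq_tsub_tsub]

theorem IsKoszulChain.koszulD {p j : ℕ} {f : Finset σ → MvPolynomial σ k}
    (hf : IsKoszulChain (p + 1) j f) : IsKoszulChain p j (koszulD (X (R := k)) f) := by
  intro T m hm
  rw [coeff_koszulD] at hm
  obtain ⟨x, hx, hne⟩ := Finset.exists_ne_zero_of_sum_ne_zero hm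
  have hxT : x ∉ T := by simpa using hx
  split_ifs at hne with hxm
  · obtain ⟨h1, h2⟩ := hf _ _ (fun h => hne (by rw [h, smul_zero]))
    rw [Finset.card_insert_of_notMem hxT] at h1 h2
    have h3 : (m - Finsupp.single x 1) + Finsupp.single x 1 = m := tsub_add_cancel_of_le (by
      rw [Finsupp.single_le_iff]
      exact Nat.one_le_iff_ne_zero.2 (Finsupp.mem_support_iff.1 hxm))
    have h4 := congrArg Finsupp.degree h3
    rw [map_add, Finsupp.degree_single] at h4
    omega
  · simp at hne

/-- The Koszul chain of internal degree `j` with prescribed components. -/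
noncomputable def koszulChainOfComponents (j : ℕ) (c : (σ →₀ ℕ) → Finset σ → k) :
    Finset σ → MvPolynomial σ k :=
  fun T => ∑ m ∈ (Finset.univ : Finset σ).finsuppAntidiag j,
    if T ⊆ m.support then monomial (m - faceExponent T) (c m T) else 0

theorem coeff_koszulChainOfComponents (j : ℕ) (c : (σ →₀ ℕ) → Finset σ → k) (T : Finset σ)
    (a : σ →₀ ℕ) : coeff a (koszulChainOfComponents j c T) =
      if a.degree + T.card = j then c (a + faceExponent T) T else 0 := by
  rw [koszulChainOfComponents, coeff_sum]
  have hmem : ∀ m : σ →₀ ℕ, m ∈ (Finset.univ : Finset σ).finsuppAntidiag j ↔ m.degree = j := by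
    intro m
    rw [Finset.mem_finsuppAntidiag, Finsupp.degree_eq_sum]
    simp
  have hdeg : (a + faceExponent T).degree = a.degree + T.card := by
    rw [map_add, degree_faceExponent]
  have hz : ∀ m, m ≠ a + faceExponent T →
      coeff a (if T ⊆ m.support then monomial (m - faceExponent T) (c m T) else 0) = 0 := by
    intro m hm
    split_ifs with hT
    · rw [coeff_monomial, if_neg]
      intro h
      exact hm (by rw [← h, tsub_add_cancel_of_le (faceExponent_le_iff.2 hT)])
    · simp
  split_ifs with h
  · rw [Finset.sum_eq_single (a + faceExponent T) (fun m _ hm => hz m hm)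
      (fun hn => (hn ((hmem _).2 (hdeg.trans h))).elim),
      if_pos (faceExponent_le_iff.1 le_add_self), add_tsub_cancel_right, coeff_monomial, if_pos rfl]
  · refine Finset.sum_eq_zero fun m hm => hz m fun e => h ?_
    rw [← hdeg, ← e, (hmem m).1 hm]

theorem multidegreeComponent_koszulChainOfComponents (j : ℕ) (c : (σ →₀ ℕ) → Finset σ → k)
    (m : σ →₀ ℕ) (T : Finset σ) : multidegreeComponent m (koszulChainOfComponents j c) T =
      if m.degree = j ∧ T ⊆ m.support then c m T else 0 := by
  rw [multidegreeComponent]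
  by_cases hT : T ⊆ m.support
  · have h1 := tsub_add_cancel_of_le (faceExponent_le_iff.2 hT)
    have h2 := congrArg Finsupp.degree h1
    rw [map_add, degree_faceExponent] at h2
    rw [if_pos hT, coeff_koszulChainOfComponents, h1, h2]
    simp [hT]
  · simp [hT]

theorem chainBoundary_indicator_multidegreeFaces {P : (σ →₀ ℕ) → Prop}
    (hP : ∀ a b, a ≤ b → P a → P b) {m : σ →₀ ℕ} {c : Finset σ → k}
    (hc : ∀ T, c T ≠ 0 → T ⊆ m.support) {T : Finset σ} (hT : T ∈ multidegreeFaces P m) :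
    chainBoundary ((multidegreeFaces P m).indicator c) T = chainBoundary c T := by
  refine chainBoundary_congr fun x hx => ?_
  by_cases h : insert x T ∈ multidegreeFaces P m
  · rw [Set.indicator_of_mem h]
  · rw [Set.indicator_of_notMem h]
    by_contra hne
    refine h ⟨hc _ (Ne.symm hne), fun hPx => hT.2 (hP _ _ ?_ hPx)⟩
    rw [faceExponent_insert hx, tsub_add_eq_tsub_tsub]
    exact tsub_le_self

/-- The Koszul complex is the direct sum of its multidegree components, and in multidegree `m` the
coefficient at `T` is a multiple of the monomial `m - faceExponent T`. Monotonicity of `P` lets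
chains be truncated to the faces whose monomial survives in the quotient. -/
theorem monomialKoszulExact_iff {P : (σ →₀ ℕ) → Prop} (hP : ∀ a b, a ≤ b → P a → P b)
    {p j : ℕ} : MonomialKoszulExact k P p j ↔
      ∀ m : σ →₀ ℕ, m.degree = j → IsAcyclicAt k (multidegreeFaces P m) p := by
  have hsupp : ∀ (m : σ →₀ ℕ) (f : Finset σ → MvPolynomial σ k) T,
      multidegreeComponent m f T ≠ 0 → T ⊆ m.support := fun m f T h => by
    by_contra hT
    exact h (if_neg hT)
  have hcard : ∀ {p : ℕ} (m : σ →₀ ℕ) {f : Finset σ → MvPolynomial σ k}, IsKoszulChain p j f →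
      ∀ T, multidegreeComponent m f T ≠ 0 → T.card = p := fun m f hf T h => by
    rw [multidegreeComponent, if_pos (hsupp m f T h)] at h
    exact (hf _ _ h).1
  have hmemX : ∀ (a : σ →₀ ℕ) (T : Finset σ), ¬ P a →
      T ∈ multidegreeFaces P (a + faceExponent T) := fun a T ha =>
    ⟨faceExponent_le_iff.1 le_add_self, by rwa [add_tsub_cancel_right]⟩
  constructor
  · intro hex m hm c hc hcyc
    set f := koszulChainOfComponents j (fun m' => if m' = m then c else 0) with hf
    have hfm : multidegreeComponent m f = c := by
      ext T
      rw [hf, multidegreeComponent_koszulChainOfComponents, if_pos rfl]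
      split_ifs with h
      · rfl
      · by_contra hne
        exact h ⟨hm, (hc T (Ne.symm hne)).1.1⟩
    obtain ⟨g, hg, hfg⟩ := hex f
      (fun T a ha => by
        rw [hf, coeff_koszulChainOfComponents] at ha
        split_ifs at ha with h1 h2
        · exact ⟨(hc T ha).2, h1⟩
        · simp at ha
        · simp at ha)
      (fun T a ha => by
        have h1 := chainBoundary_multidegreeComponent f
          (faceExponent_le_iff.1 (le_add_self : faceExponent T ≤ a + faceExponent T))
        rw [add_tsub_cancel_right] at h1
        rw [← h1]
        by_cases hma : a + faceExponent T = m
        · rw [hma, hfm]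
          exact hcyc T (hma ▸ hmemX a T ha)
        · refine chainBoundary_eq_zero fun x _ => ?_
          rw [hf, multidegreeComponent_koszulChainOfComponents, if_neg hma]
          simp)
    refine ⟨(multidegreeFaces P m).indicator (multidegreeComponent m g), fun T hT => ?_,
      fun T hT => ?_⟩
    · have hTX := Set.mem_of_indicator_ne_zero hT
      rw [Set.indicator_of_mem hTX] at hT
      exact ⟨hTX, hcard m hg T hT⟩
    · rw [chainBoundary_indicator_multidegreeFaces hP (hsupp m g) hT,
        chainBoundary_multidegreeComponent g hT.1, ← hfg T _ hT.2, ← hfm, multidegreeComponent,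
        if_pos hT.1]
  · intro hac f hf hcyc
    have hex : ∀ m : σ →₀ ℕ, ∃ e : Finset σ → k, m.degree = j →
        (∀ T, e T ≠ 0 → T ∈ multidegreeFaces P m ∧ T.card = p + 1) ∧
        ∀ T ∈ multidegreeFaces P m, chainBoundary e T = multidegreeComponent m f T := by
      intro m
      by_cases hm : m.degree = j
      · obtain ⟨e, he, heb⟩ := hac m hm ((multidegreeFaces P m).indicator (multidegreeComponent m f))
          (fun T hT => by
            have hTX := Set.mem_of_indicator_ne_zero hT
            rw [Set.indicator_of_mem hTX] at hT
            exact ⟨hTX, hcard m hf T hT⟩)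
          (fun T hT => by
            rw [chainBoundary_indicator_multidegreeFaces hP (hsupp m f) hT,
              chainBoundary_multidegreeComponent f hT.1]
            exact hcyc T _ hT.2)
        exact ⟨e, fun _ => ⟨he, fun T hT => by rw [heb T hT, Set.indicator_of_mem hT]⟩⟩
      · exact ⟨0, fun h => (hm h).elim⟩
    choose e he using hex
    have hg : IsKoszulChain (p + 1) j (koszulChainOfComponents j e) := by
      intro T a ha
      rw [coeff_koszulChainOfComponents] at ha
      split_ifs at ha with h1
      · refine ⟨((he _ ?_).1 T ha).2, h1⟩
        rw [map_add, degree_faceExponent, h1]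
      · simp at ha
    refine ⟨koszulChainOfComponents j e, hg, fun T a ha => ?_⟩
    by_cases hdeg : a.degree + T.card = j
    · have hm : (a + faceExponent T).degree = j := by rw [map_add, degree_faceExponent, hdeg]
      have h1 := chainBoundary_multidegreeComponent (koszulChainOfComponents j e)
        (faceExponent_le_iff.1 (le_add_self : faceExponent T ≤ a + faceExponent T))
      rw [add_tsub_cancel_right] at h1
      rw [← h1, coeff_eq_multidegreeComponent, ← (he _ hm).2 T (hmemX a T ha)]
      refine chainBoundary_congr fun x _ => ?_
      rw [multidegreeComponent_koszulChainOfComponents]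
      split_ifs with h
      · rfl
      · by_contra hne
        exact h ⟨hm, ((he _ hm).1 _ hne).1.1⟩
    · have h1 : coeff a (f T) = 0 := by
        by_contra h
        exact hdeg (hf T a h).2
      have h2 : coeff a (koszulD (X (R := k)) (koszulChainOfComponents j e) T) = 0 := by
        by_contra h
        exact hdeg (hg.koszulD T a h).2
      rw [h1, h2]

theorem isAcyclicAt_of_card_ne {X : Set (Finset σ)} {p : ℕ} (h : ∀ T ∈ X, T.card ≠ p) :
    IsAcyclicAt k X p := fun c hc _ => ⟨0, by simp, fun T _ => by
  rw [map_zero, Pi.zero_apply]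
  by_contra hne
  exact h T (hc T (Ne.symm hne)).1 (hc T (Ne.symm hne)).2⟩

/-- The Koszul complex of the polynomial ring is exact, except in homological degree zero and
internal degree zero. -/
theorem monomialKoszulExact_false {p j : ℕ} (h : p ≠ 0 ∨ j ≠ 0) :
    MonomialKoszulExact (σ := σ) k (fun _ => False) p j := by
  refine (monomialKoszulExact_iff (by simp)).2 fun m hm => ?_
  rcases eq_or_ne m 0 with rfl | hm0
  · refine isAcyclicAt_of_card_ne fun T hT => ?_
    have : T = ∅ := by simpa using hT.1
    rw [this, Finset.card_empty]
    rw [map_zero] at hm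
    omega
  · obtain ⟨x, hx⟩ := Finsupp.support_nonempty_iff.2 hm0
    refine isAcyclicAt_of_cone x (fun T _ => ?_) p
    simp [multidegreeFaces, Finset.insert_subset_iff, hx]

theorem HasKoszulHomology.not_monomialKoszulExact {𝓕 : Set (Finset σ)} {W : Finset σ} {p : ℕ}
    (h : HasKoszulHomology k 𝓕 W p) : ¬ MonomialKoszulExact k (SquarefreeExponent 𝓕) p W.card := by
  intro hex
  have := (monomialKoszulExact_iff SquarefreeExponent.mono).1 hex _ (degree_faceExponent W)
  rw [multidegreeFaces_faceExponent] at this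
  exact h this

/-- Some multidegree `m` of degree `|V|` carries homology. It is squarefree with support covered by
members of `𝓕`, hence inside `V`, and comparing sizes gives `m.support = V`. -/
theorem hasKoszulHomology_of_not_monomialKoszulExact {𝓕 : Set (Finset σ)} {V : Finset σ} {p : ℕ}
    (hV : ∀ F ∈ 𝓕, F ⊆ V) (h : ¬ MonomialKoszulExact k (SquarefreeExponent 𝓕) p V.card) :
    HasKoszulHomology k 𝓕 V p := by
  rw [monomialKoszulExact_iff SquarefreeExponent.mono] at h
  push Not at h
  obtain ⟨m, hm, hac⟩ := h
  -- If `m x ≥ 2`, removing one `x` does not change the support of the complementary monomial, so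
  -- the faces form a cone with apex `x`.
  have hle : ∀ x, m x ≤ 1 := by
    by_contra! hc
    obtain ⟨x, hx⟩ := hc
    refine hac (isAcyclicAt_of_cone x (fun T hxT => and_congr ?_ (not_congr ?_)) p)
    · have : x ∈ m.support := by rw [Finsupp.mem_support_iff]; omega
      simp [Finset.insert_subset_iff, this]
    · have : (m - faceExponent T).support = (m - faceExponent (insert x T)).support := by
        ext y
        simp only [Finsupp.mem_support_iff, Finsupp.tsub_apply, faceExponent_apply,
          Finset.mem_insert]
        by_cases hy : y = x
        · subst hy; simp [hxT]; omega
        · simp [hy]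
      rw [SquarefreeExponent, SquarefreeExponent, this]
  have hmf : m = faceExponent m.support := by
    ext x
    rw [faceExponent_apply]
    have := hle x
    split_ifs with h
    · rw [Finsupp.mem_support_iff] at h; omega
    · simpa using h
  rw [hmf, multidegreeFaces_faceExponent] at hac
  rw [hmf, degree_faceExponent] at hm
  have hsub : m.support ⊆ V := fun x hx => by
    obtain ⟨H, hH, -, hxH⟩ := HasKoszulHomology.exists_mem (k := k) hac hx
    exact hV H hH hxH
  rwa [Finset.eq_of_subset_of_card_le hsub hm.ge] at hac

end MonomialKoszul

/-! ### Balancing: moving homology along the staircase of a double complex -/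

section DoubleComplex

/-- A first-quadrant double complex with exact columns away from the bottom row, exact rows away
from the left column, and such that the rows vanish on the bottom homology. -/
structure ExactDoubleComplex (W : ℕ → Type*) [∀ i, AddCommGroup (W i)] where
  /-- the chains of bidegree `(i, p)` -/
  chains : ∀ i, ℕ → AddSubgroup (W i)
  /-- the vertical differential -/
  vert : ∀ i, W i →+ W i
  /-- the horizontal differential -/
  horiz : ∀ i, W (i + 1) →+ W i
  vert_mem : ∀ {i p w}, w ∈ chains i (p + 1) → vert i w ∈ chains i p
  horiz_mem : ∀ {i p w}, w ∈ chains (i + 1) p → horiz i w ∈ chains i p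
  vert_vert : ∀ i w, vert i (vert i w) = 0
  horiz_horiz : ∀ i w, horiz i (horiz (i + 1) w) = 0
  vert_horiz : ∀ i w, vert i (horiz i w) = horiz i (vert (i + 1) w)
  exact_vert : ∀ {i p w}, w ∈ chains i (p + 1) → vert i w = 0 →
    ∃ v ∈ chains i (p + 2), vert i v = w
  exact_horiz : ∀ {i p w}, w ∈ chains (i + 1) p → horiz i w = 0 →
    ∃ v ∈ chains (i + 2) p, horiz (i + 1) v = w
  minimal : ∀ {i w}, w ∈ chains (i + 1) 0 → ∃ v ∈ chains i 1, vert i v = horiz i w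

namespace ExactDoubleComplex

variable {W : ℕ → Type*} [∀ i, AddCommGroup (W i)] (C : ExactDoubleComplex W)

/-- The homology of the cokernel of the horizontal differential at position `(i, p)` vanishes. -/
def VanishesAt (i : ℕ) : ℕ → Prop
  | 0 => ∀ w ∈ C.chains i 0, ∃ y ∈ C.chains i 1, ∃ z ∈ C.chains (i + 1) 0,
      w = C.vert i y + C.horiz i z
  | p + 1 => ∀ w ∈ C.chains i (p + 1), (∃ v ∈ C.chains (i + 1) p, C.vert i w = C.horiz i v) →
      ∃ y ∈ C.chains i (p + 2), ∃ z ∈ C.chains (i + 1) (p + 1), w = C.vert i y + C.horiz i z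

variable {C}

theorem VanishesAt.exists_eq {i p : ℕ} (h : C.VanishesAt i p) {w : W i} (hw : w ∈ C.chains i p)
    (hv : p ≠ 0 → ∃ v ∈ C.chains (i + 1) (p - 1), C.vert i w = C.horiz i v) :
    ∃ y ∈ C.chains i (p + 1), ∃ z ∈ C.chains (i + 1) p, w = C.vert i y + C.horiz i z := by
  cases p with
  | zero => exact h w hw
  | succ p => exact h w hw (hv (Nat.succ_ne_zero p))

theorem vanishesAt_of_forall {i p : ℕ}
    (h : ∀ w ∈ C.chains i p,
      (p ≠ 0 → ∃ v ∈ C.chains (i + 1) (p - 1), C.vert i w = C.horiz i v) →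
      ∃ y ∈ C.chains i (p + 1), ∃ z ∈ C.chains (i + 1) p, w = C.vert i y + C.horiz i z) :
    C.VanishesAt i p := by
  cases p with
  | zero => exact fun w hw => h w hw (fun h0 => (h0 rfl).elim)
  | succ p => exact fun w hw hv => h w hw (fun _ => hv)

/-- Dimension shifting: for syzygies `0 → M_{i+1} → F_i → M_i → 0` with `F_i` free, `Tor_{p+1}(M_i,
k) ≅ Tor_p(M_{i+1}, k)`. At `p = 0` this also requires `M_{i+1} ⊗ k → F_i ⊗ k` to be zero, which is
minimality. -/
theorem vanishesAt_succ_left_iff (i p : ℕ) : C.VanishesAt (i + 1) p ↔ C.VanishesAt i (p + 1) := by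
  constructor
  · rintro h w hw ⟨v, hv, hwv⟩
    have hDv : C.horiz i (C.vert (i + 1) v) = 0 := by
      rw [← C.vert_horiz, ← hwv, C.vert_vert]
    obtain ⟨y, hy, z, hz, rfl⟩ := h.exists_eq hv (fun hp => by
      obtain ⟨q, rfl⟩ := Nat.exists_eq_succ_of_ne_zero hp
      obtain ⟨u, hu, hu'⟩ := C.exact_horiz (C.vert_mem hv) hDv
      exact ⟨u, hu, hu'.symm⟩)
    rw [map_add, C.horiz_horiz, add_zero, ← C.vert_horiz] at hwv
    obtain ⟨x, hx, hx'⟩ := C.exact_vert (sub_mem hw (C.horiz_mem hy)) (by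
      rw [map_sub, hwv, sub_self])
    exact ⟨x, hx, y, hy, by rw [hx', sub_add_cancel]⟩
  · intro h
    refine vanishesAt_of_forall fun v hv hcond => ?_
    obtain ⟨w, hw, hwv⟩ : ∃ w ∈ C.chains i (p + 1), C.vert i w = C.horiz i v := by
      cases p with
      | zero => exact C.minimal hv
      | succ p =>
        obtain ⟨u, -, hu⟩ := hcond (Nat.succ_ne_zero p)
        exact C.exact_vert (C.horiz_mem hv) (by rw [C.vert_horiz, hu, C.horiz_horiz])
    obtain ⟨y, hy, z, hz, rfl⟩ := h w hw ⟨v, hv, hwv⟩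
    rw [map_add, C.vert_vert, zero_add, C.vert_horiz] at hwv
    obtain ⟨x, hx, hx'⟩ := C.exact_horiz (sub_mem hv (C.vert_mem hz)) (by
      rw [map_sub, hwv, sub_self])
    exact ⟨z, hz, x, hx, by rw [hx', add_sub_cancel]⟩

theorem vanishesAt_iff (i p : ℕ) : C.VanishesAt i p ↔ C.VanishesAt 0 (i + p) := by
  induction i generalizing p with
  | zero => rw [zero_add]
  | succ i ih => rw [vanishesAt_succ_left_iff, ih, Nat.add_right_comm, Nat.add_assoc]

end ExactDoubleComplex

end DoubleComplex

/-! ### Homogeneous components in graded free modules -/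

section GradedComponents

open MvPolynomial

variable {σ k ι κ : Type*} [Field k]

/-- Vectors of degree `e` in the graded free module with basis elements of degrees `deg`. -/
def IsHomogeneousVector (deg : ι → ℕ) (e : ℕ) (x : ι →₀ MvPolynomial σ k) : Prop :=
  ∀ b m, coeff m (x b) ≠ 0 → m.degree + deg b = e

/-- The component of degree `e` of a vector in the graded free module with basis elements of
degrees `deg`. -/
noncomputable def gradedComponent (deg : ι → ℕ) (e : ℕ) (x : ι →₀ MvPolynomial σ k) :
    ι →₀ MvPolynomial σ k :=
  Finsupp.onFinset x.support
    (fun b => if deg b ≤ e then homogeneousComponent (e - deg b) (x b) else 0) (fun b hb => by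
      rw [Finsupp.mem_support_iff]
      intro h
      simp [h] at hb)

theorem coeff_gradedComponent (deg : ι → ℕ) (e : ℕ) (x : ι →₀ MvPolynomial σ k) (b : ι)
    (m : σ →₀ ℕ) : coeff m (gradedComponent deg e x b) =
      if m.degree + deg b = e then coeff m (x b) else 0 := by
  rw [gradedComponent, Finsupp.onFinset_apply]
  split_ifs with h1 h2 h2
  · rw [coeff_homogeneousComponent, if_pos (by omega)]
  · rw [coeff_homogeneousComponent, if_neg (by omega)]
  · omega
  · rw [coeff_zero]

theorem finsupp_ext_coeff {x y : ι →₀ MvPolynomial σ k}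
    (h : ∀ b m, coeff m (x b) = coeff m (y b)) : x = y :=
  Finsupp.ext fun b => MvPolynomial.ext _ _ (h b)

theorem gradedComponent_add (deg : ι → ℕ) (e : ℕ) (x y : ι →₀ MvPolynomial σ k) :
    gradedComponent deg e (x + y) = gradedComponent deg e x + gradedComponent deg e y := by
  refine finsupp_ext_coeff fun b m => ?_
  simp only [coeff_gradedComponent, Finsupp.add_apply, coeff_add]
  split_ifs <;> simp

theorem gradedComponent_zero (deg : ι → ℕ) (e : ℕ) :
    gradedComponent deg e (0 : ι →₀ MvPolynomial σ k) = 0 := by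
  refine finsupp_ext_coeff fun b m => ?_
  simp [coeff_gradedComponent]

theorem isHomogeneousVector_gradedComponent (deg : ι → ℕ) (e : ℕ) (x : ι →₀ MvPolynomial σ k) :
    IsHomogeneousVector deg e (gradedComponent deg e x) := by
  intro b m hm
  rw [coeff_gradedComponent] at hm
  by_contra h
  exact hm (if_neg h)

theorem IsHomogeneousVector.gradedComponent_eq {deg : ι → ℕ} {e : ℕ} {x : ι →₀ MvPolynomial σ k}
    (hx : IsHomogeneousVector deg e x) : gradedComponent deg e x = x := by
  refine finsupp_ext_coeff fun b m => ?_
  rw [coeff_gradedComponent]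
  split_ifs with h
  · rfl
  · by_contra hne
    exact h (hx b m (Ne.symm hne))

/-- A functional that is homogeneous of degree `-c` commutes with taking components. -/
theorem coeff_map_gradedComponent {deg : ι → ℕ} {c : ℕ}
    {L : (ι →₀ MvPolynomial σ k) →ₗ[MvPolynomial σ k] MvPolynomial σ k}
    (hL : ∀ b m, coeff m (L (Finsupp.single b 1)) ≠ 0 → m.degree + c = deg b) (e : ℕ)
    (x : ι →₀ MvPolynomial σ k) (m : σ →₀ ℕ) :
    coeff m (L (gradedComponent deg e x)) = if m.degree + c = e then coeff m (L x) else 0 := by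
  induction x using Finsupp.induction_linear with
  | zero => simp [gradedComponent_zero]
  | add x y hx hy =>
    rw [gradedComponent_add, map_add, coeff_add, hx, hy, map_add, coeff_add]
    split_ifs <;> simp
  | single b q =>
    induction q using MvPolynomial.induction_on' with
    | add p q hp hq =>
      rw [Finsupp.single_add, gradedComponent_add, map_add, coeff_add, hp, hq, map_add, coeff_add]
      split_ifs <;> simp
    | monomial n a =>
      classical
      have hLs : L (Finsupp.single b (monomial n a)) =
          monomial n a * L (Finsupp.single b 1) := by
        rw [← smul_eq_mul, ← map_smul, Finsupp.smul_single, smul_eq_mul, mul_one]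
      have hcomp : gradedComponent deg e (Finsupp.single b (monomial n a)) =
          if n.degree + deg b = e then Finsupp.single b (monomial n a) else 0 := by
        refine finsupp_ext_coeff fun b' m' => ?_
        rw [coeff_gradedComponent]
        by_cases hb : b' = b
        · subst hb
          rw [Finsupp.single_eq_same, coeff_monomial]
          by_cases hm : n = m'
          · subst hm
            split_ifs <;> simp_all
          · split_ifs <;> simp [coeff_monomial, hm]
        · have : Finsupp.single b (monomial n a) b' = 0 := Finsupp.single_eq_of_ne hb
          split_ifs <;> simp [this]
      have hcoeff : coeff m (monomial n a * L (Finsupp.single b 1)) ≠ 0 →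
          m.degree + c = n.degree + deg b := by
        rw [coeff_monomial_mul']
        split_ifs with hle
        · intro hne
          have h1 := hL b (m - n) (right_ne_zero_of_mul hne)
          have h2 := congrArg Finsupp.degree (tsub_add_cancel_of_le hle)
          rw [map_add] at h2
          omega
        · simp
      rw [hcomp]
      by_cases h0 : coeff m (monomial n a * L (Finsupp.single b 1)) = 0
      · split_ifs <;> simp [hLs, h0]
      · rw [← hcoeff h0]
        split_ifs <;> simp [hLs]

theorem map_gradedComponent {deg : ι → ℕ} {deg' : κ → ℕ}
    {L : (ι →₀ MvPolynomial σ k) →ₗ[MvPolynomial σ k] (κ →₀ MvPolynomial σ k)}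
    (hL : ∀ b c m, coeff m (L (Finsupp.single b 1) c) ≠ 0 → m.degree + deg' c = deg b) (e : ℕ)
    (x : ι →₀ MvPolynomial σ k) :
    L (gradedComponent deg e x) = gradedComponent deg' e (L x) := by
  refine finsupp_ext_coeff fun c m => ?_
  rw [coeff_gradedComponent]
  exact coeff_map_gradedComponent (L := Finsupp.lapply c ∘ₗ L) (fun b m => hL b c m) e x m

end GradedComponents

/-! ### Koszul chains with coefficients in a graded free module -/

section FreeKoszulChains

open MvPolynomial

variable {σ k ι κ : Type*} [Field k]

/-- The Koszul chains of homological degree `p` and internal degree `j` with coefficients in the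
graded free module with basis elements of degrees `deg`. -/
def freeKoszulChains (k : Type*) [Field k] (deg : ι → ℕ) (p j : ℕ) :
    AddSubgroup (Finset σ → ι →₀ MvPolynomial σ k) where
  carrier := {w | ∀ T b m, coeff m (w T b) ≠ 0 → T.card = p ∧ m.degree + T.card + deg b = j}
  zero_mem' := by simp
  add_mem' := by
    intro v w hv hw T b m h
    by_cases h0 : coeff m (v T b) = 0
    · exact hw T b m (fun h1 => h (by simp [h0, h1]))
    · exact hv T b m h0
  neg_mem' := by
    intro w hw T b m h
    exact hw T b m (by simpa using h)

theorem mem_freeKoszulChains {deg : ι → ℕ} {p j : ℕ} {w : Finset σ → ι →₀ MvPolynomial σ k} :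
    w ∈ freeKoszulChains k deg p j ↔
      ∀ T b m, coeff m (w T b) ≠ 0 → T.card = p ∧ m.degree + T.card + deg b = j := Iff.rfl

theorem mem_freeKoszulChains_iff_forall {deg : ι → ℕ} {p j : ℕ}
    {w : Finset σ → ι →₀ MvPolynomial σ k} :
    w ∈ freeKoszulChains k deg p j ↔
      ∀ b, IsKoszulChain p (j - deg b) (fun T => w T b) ∧ (j < deg b → ∀ T, w T b = 0) := by
  rw [mem_freeKoszulChains]
  constructor
  · refine fun h b => ⟨fun T m hm => ?_, fun hj T => MvPolynomial.ext _ _ fun m => ?_⟩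
    · have := h T b m hm
      omega
    · rw [coeff_zero]
      by_contra hne
      have := h T b m hne
      omega
  · intro h T b m hm
    have h1 := (h b).1 T m hm
    have h2 : ¬ j < deg b := fun hj => hm (by rw [(h b).2 hj T, coeff_zero])
    omega

/-- Homogeneous maps of graded free modules act on Koszul chains. -/
theorem map_mem_freeKoszulChains {deg : ι → ℕ} {deg' : κ → ℕ}
    {L : (ι →₀ MvPolynomial σ k) →ₗ[MvPolynomial σ k] (κ →₀ MvPolynomial σ k)}
    (hL : ∀ b c m, coeff m (L (Finsupp.single b 1) c) ≠ 0 → m.degree + deg' c = deg b)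
    {p j : ℕ} {w : Finset σ → ι →₀ MvPolynomial σ k} (hw : w ∈ freeKoszulChains k deg p j) :
    (fun T => L (w T)) ∈ freeKoszulChains k deg' p j := by
  intro T c m hm
  have hT : T.card = p ∧ T.card ≤ j := by
    by_contra hT
    refine hm ?_
    have : w T = 0 := finsupp_ext_coeff fun b m => by
      rw [Finsupp.coe_zero, Pi.zero_apply, coeff_zero]
      by_contra hne
      have := hw T b m hne
      omega
    simp [this]
  have hhom : IsHomogeneousVector deg (j - T.card) (w T) := fun b m hm => by
    have := hw T b m hm
    omega
  have h1 := map_gradedComponent hL (j - T.card) (w T)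
  rw [hhom.gradedComponent_eq] at h1
  have h2 := isHomogeneousVector_gradedComponent deg' (j - T.card) (L (w T))
  rw [← h1] at h2
  have := h2 c m hm
  omega

/-- A chain of vectors in the image of a homogeneous map lifts to a chain. -/
theorem exists_lift_freeKoszulChains {deg : ι → ℕ} {deg' : κ → ℕ}
    {L : (ι →₀ MvPolynomial σ k) →ₗ[MvPolynomial σ k] (κ →₀ MvPolynomial σ k)}
    (hL : ∀ b c m, coeff m (L (Finsupp.single b 1) c) ≠ 0 → m.degree + deg' c = deg b)
    {p j : ℕ} {w : Finset σ → κ →₀ MvPolynomial σ k} (hw : w ∈ freeKoszulChains k deg' p j)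
    (hrange : ∀ T, ∃ x, L x = w T) :
    ∃ v ∈ freeKoszulChains k deg p j, ∀ T, L (v T) = w T := by
  choose v hv using hrange
  refine ⟨fun T => if T.card = p ∧ p ≤ j then gradedComponent deg (j - p) (v T) else 0, ?_, ?_⟩
  · intro T b m hm
    dsimp only at hm
    split_ifs at hm with h
    · have := isHomogeneousVector_gradedComponent _ _ _ b m hm
      omega
    · simp at hm
  · intro T
    dsimp only
    split_ifs with h
    · rw [map_gradedComponent hL, hv]
      refine IsHomogeneousVector.gradedComponent_eq fun c m hm => ?_
      have := hw T c m hm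
      omega
    · rw [map_zero]
      refine finsupp_ext_coeff fun c m => ?_
      rw [Finsupp.coe_zero, Pi.zero_apply, coeff_zero]
      by_contra hne
      have := hw T c m (Ne.symm hne)
      omega

variable [Fintype σ] [LinearOrder σ]

theorem koszulD_apply_apply (w : Finset σ → ι →₀ MvPolynomial σ k) (T : Finset σ) (b : ι) :
    koszulD (X (R := k)) w T b = koszulD (X (R := k)) (fun T => w T b) T :=
  (koszulD_map (X (R := k)) (Finsupp.lapply b) w T).symm

theorem koszulD_mem_freeKoszulChains {deg : ι → ℕ} {p j : ℕ}
    {w : Finset σ → ι →₀ MvPolynomial σ k} (hw : w ∈ freeKoszulChains k deg (p + 1) j) :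
    koszulD (X (R := k)) w ∈ freeKoszulChains k deg p j := by
  rw [mem_freeKoszulChains_iff_forall] at hw ⊢
  intro b
  simp only [koszulD_apply_apply]
  refine ⟨(hw b).1.koszulD, fun hj T => ?_⟩
  simp [koszulD_apply, (hw b).2 hj]

theorem constantCoeff_koszulD (f : Finset σ → MvPolynomial σ k) (T : Finset σ) :
    coeff 0 (koszulD (X (R := k)) f T) = 0 := by
  rw [coeff_koszulD]
  simp

/-- The Koszul complex of a graded free module is exact away from its generators. -/
theorem exists_koszulD_eq [Finite ι] {deg : ι → ℕ} {p j : ℕ}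
    {w : Finset σ → ι →₀ MvPolynomial σ k} (hw : w ∈ freeKoszulChains k deg p j)
    (hcyc : p ≠ 0 → koszulD (X (R := k)) w = 0) (h0 : p = 0 → ∀ b, coeff 0 (w ∅ b) = 0) :
    ∃ v ∈ freeKoszulChains k deg (p + 1) j, koszulD (X (R := k)) v = w := by
  have hex : ∀ b, ∃ g : Finset σ → MvPolynomial σ k,
      (IsKoszulChain (p + 1) (j - deg b) g ∧ (j < deg b → ∀ T, g T = 0)) ∧
        ∀ T, koszulD (X (R := k)) g T = w T b := by
    intro b
    obtain ⟨h1, h2⟩ := mem_freeKoszulChains_iff_forall.1 hw b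
    by_cases hz : ∀ T, w T b = 0
    · refine ⟨0, ⟨fun T m hm => by simp at hm, fun _ _ => rfl⟩, fun T => ?_⟩
      rw [map_zero, hz T, Pi.zero_apply]
    · have hj : ¬ j < deg b := fun hj => hz (h2 hj)
      obtain ⟨g, hg, hgw⟩ := monomialKoszulExact_false (σ := σ) (k := k) (p := p)
        (j := j - deg b) (by
          by_contra! hpj
          refine hz fun T => MvPolynomial.ext _ _ fun m => ?_
          rw [coeff_zero]
          by_contra hne
          have h3 := h1 T m hne
          have hT : T = ∅ := Finset.card_eq_zero.1 (by omega)
          have hm : m = 0 := (Finsupp.degree_eq_zero_iff m).1 (by omega)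
          subst hT hm
          exact hne (h0 hpj.1 b)) _ h1 (fun T m _ => by
          by_cases hp : p = 0
          · rw [coeff_koszulD]
            refine Finset.sum_eq_zero fun x hx => ?_
            split_ifs
            · by_contra hne
              have h3 := (h1 _ _ (fun h => hne (by rw [h, smul_zero]))).1
              rw [hp, Finset.card_eq_zero] at h3
              exact Finset.insert_ne_empty _ _ h3
            · rw [smul_zero]
          · rw [← koszulD_apply_apply, hcyc hp]
            simp)
      refine ⟨g, ⟨hg, fun h => (hj h).elim⟩, fun T => MvPolynomial.ext _ _ fun m => ?_⟩
      exact (hgw T m not_false).symm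
  choose g hg hgw using hex
  refine ⟨fun T => Finsupp.equivFunOnFinite.symm fun b => g b T, ?_, ?_⟩
  · rw [mem_freeKoszulChains_iff_forall]
    exact hg
  · ext1 T
    ext1 b
    rw [koszulD_apply_apply]
    exact hgw b T

end FreeKoszulChains

/-! ### Betti numbers as Koszul homology -/

namespace MinimalGradedFreeResolution

open MvPolynomial

variable {σ : Type*} {k : Type*} [Field k]
  {I : Ideal (MvPolynomial σ k)} (R : MinimalGradedFreeResolution I)

theorem coeff_d_single {i : ℕ} (b : R.ι (i + 1)) (c : R.ι i) (m : σ →₀ ℕ)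
    (h : coeff m (R.d i (Finsupp.single b 1) c) ≠ 0) : m.degree + R.deg i c = R.deg (i + 1) b :=
  R.d_homogeneous i b c m (mem_support_iff.2 h)

/-- A lift of the augmentation to `k[σ]`, together with a section modulo the ideal. -/
theorem exists_augmentation_lift {P : (σ →₀ ℕ) → Prop}
    (hI : ∀ f : MvPolynomial σ k, f ∈ I ↔ ∀ m, ¬ P m → coeff m f = 0) :
    ∃ (θ : (R.ι 0 →₀ MvPolynomial σ k) →ₗ[MvPolynomial σ k] MvPolynomial σ k)
      (x₁ : R.ι 0 →₀ MvPolynomial σ k),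
      (∀ b m, coeff m (θ (Finsupp.single b 1)) ≠ 0 → m.degree + 0 = R.deg 0 b) ∧
      (∀ x, θ x ∈ I ↔ ∃ y, R.d 0 y = x) ∧
      IsHomogeneousVector (R.deg 0) 0 x₁ ∧ ∀ f : MvPolynomial σ k, θ (f • x₁) - f ∈ I := by
  choose q hq hε using R.ε_homogeneous
  set θ := Finsupp.linearCombination (MvPolynomial σ k) q with hθ
  have hmk : ∀ x, R.ε x = Ideal.Quotient.mk I (θ x) := by
    intro x
    have : R.ε = (Ideal.Quotient.mkₐ (MvPolynomial σ k) I).toLinearMap ∘ₗ θ := by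
      refine Finsupp.lhom_ext' fun b => LinearMap.ext_ring ?_
      simp [hθ, hε]
    rw [this]; rfl
  have hθhom : ∀ b m, coeff m (θ (Finsupp.single b 1)) ≠ 0 → m.degree + 0 = R.deg 0 b := by
    intro b m hm
    rw [hθ, Finsupp.linearCombination_single, one_smul] at hm
    rw [add_zero, Finsupp.degree_eq_weight_one]
    exact hq b hm
  obtain ⟨x, hx⟩ := R.ε_surjective (Ideal.Quotient.mk I 1)
  rw [hmk, Ideal.Quotient.eq] at hx
  refine ⟨θ, gradedComponent (R.deg 0) 0 x, hθhom, fun x => ?_,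
    isHomogeneousVector_gradedComponent _ _ _, fun f => ?_⟩
  · rw [← Ideal.Quotient.eq_zero_iff_mem, ← hmk]
    exact R.exact_zero x
  -- As `I` is a monomial ideal, the degree zero component of a lift of `1` is still a lift of `1`.
  · have h1 : θ (gradedComponent (R.deg 0) 0 x) - 1 ∈ I := by
      rw [hI] at hx ⊢
      intro m hm
      rw [coeff_sub, coeff_map_gradedComponent hθhom]
      split_ifs with hdeg
      · rw [← coeff_sub]
        exact hx m hm
      · have : m ≠ 0 := by rintro rfl; simp at hdeg
        classical
        rw [coeff_one, if_neg (Ne.symm this), sub_zero]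
    rw [map_smul, smul_eq_mul, ← mul_sub_one]
    exact I.mul_mem_left f h1

variable [Fintype σ] [LinearOrder σ]

/-- The Koszul complexes, in internal degree `j`, of the modules of a minimal free resolution. -/
noncomputable def koszulDoubleComplex (j : ℕ) :
    ExactDoubleComplex fun i => Finset σ → R.ι i →₀ MvPolynomial σ k where
  chains i p := freeKoszulChains k (R.deg i) p j
  vert i := (koszulD (X (R := k))).toAddMonoidHom
  horiz i := ((R.d i).compLeft (Finset σ)).toAddMonoidHom
  vert_mem h := koszulD_mem_freeKoszulChains h
  horiz_mem h := map_mem_freeKoszulChains R.coeff_d_single h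
  vert_vert i w := koszulD_koszulD _ w
  horiz_horiz i w := funext fun T => (R.exact_succ i).apply_apply_eq_zero (w T)
  vert_horiz i w := funext fun T => koszulD_map _ (R.d i) w T
  exact_vert {i p w} h hw :=
    haveI := R.finite i
    exists_koszulD_eq h (fun _ => hw) (fun h => (Nat.succ_ne_zero _ h).elim)
  exact_horiz {i p w} h hw := by
    obtain ⟨v, hv, hvw⟩ := exists_lift_freeKoszulChains R.coeff_d_single h
      (fun T => (R.exact_succ i (w T)).1 (congrFun hw T))
    exact ⟨v, hv, funext hvw⟩
  minimal {i w} h :=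
    haveI := R.finite i
    exists_koszulD_eq (p := 0) (map_mem_freeKoszulChains R.coeff_d_single h)
      (fun h => (h rfl).elim) (fun _ b => R.minimal i (w ∅) b)

/-- The group at `(i, 0)` is the degree `j` part of `F_i ⊗ k`: by minimality neither differential
reaches a constant coefficient, so the basis elements of degree `j` survive. -/
theorem koszulDoubleComplex_vanishesAt_zero_iff (i j : ℕ) :
    (R.koszulDoubleComplex j).VanishesAt i 0 ↔ ∀ b, R.deg i b ≠ j := by
  constructor
  · intro h b hb
    obtain ⟨y, -, z, -, hyz⟩ := h (fun T => if T = ∅ then Finsupp.single b 1 else 0) (by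
      intro T c m hm
      classical
      by_cases hT : T = ∅
      · subst hT
        simp only [if_true, Finsupp.single_apply] at hm
        split_ifs at hm with hbc
        · subst hbc
          rw [coeff_one] at hm
          have : m = 0 := by
            by_contra hne
            exact hm (if_neg (Ne.symm hne))
          subst this
          simpa using hb
        · simp at hm
      · simp [hT] at hm)
    have h1 := congrArg (coeff 0) (DFunLike.congr_fun (congrFun hyz ∅) b)
    change _ = coeff 0 ((koszulD (X (R := k)) y ∅ + R.d i (z ∅)) b) at h1
    have h2 : coeff 0 (R.d i (z ∅) b) = 0 := R.minimal i (z ∅) b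
    rw [Finsupp.add_apply, coeff_add, koszulD_apply_apply, constantCoeff_koszulD, h2] at h1
    simp at h1
  · intro h w hw
    have := R.finite i
    obtain ⟨v, hv, hvw⟩ := exists_koszulD_eq (p := 0) hw (fun h => (h rfl).elim) (fun _ b => by
      by_contra hne
      exact h b (by simpa using (hw ∅ b 0 hne).2))
    refine ⟨v, hv, 0, zero_mem _, ?_⟩
    rw [map_zero, add_zero]
    exact hvw.symm

/-- The cokernel of `F_1 → F_0` is `S/I`; the maps `θ` and `f ↦ f • x₁` carry Koszul chains back and
forth and are inverse to each other modulo `I` and the range of `R.d 0`. -/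
theorem koszulDoubleComplex_vanishesAt_zero_left_iff {P : (σ →₀ ℕ) → Prop}
    (hI : ∀ f : MvPolynomial σ k, f ∈ I ↔ ∀ m, ¬ P m → coeff m f = 0) (p j : ℕ) :
    (R.koszulDoubleComplex j).VanishesAt 0 (p + 1) ↔ MonomialKoszulExact k P (p + 1) j := by
  obtain ⟨θ, x₁, hθ, hker, hx₁, hsec⟩ := R.exists_augmentation_lift hI
  have hθchain : ∀ {p} {w : Finset σ → R.ι 0 →₀ MvPolynomial σ k},
      w ∈ freeKoszulChains k (R.deg 0) p j → IsKoszulChain p j (fun T => θ (w T)) := by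
    intro p w hw T m hm
    have h1 := map_mem_freeKoszulChains (L := Finsupp.lsingle () ∘ₗ θ) (deg' := fun _ : Unit => 0)
      (fun b c m hm => hθ b m (by simpa using hm)) hw T () m (by simpa using hm)
    omega
  have hτchain : ∀ {p} {f : Finset σ → MvPolynomial σ k}, IsKoszulChain p j f →
      (fun T => f T • x₁) ∈ freeKoszulChains k (R.deg 0) p j := by
    intro p f hf
    have h1 := map_mem_freeKoszulChains (ι := Unit) (deg := fun _ => 0) (deg' := R.deg 0)
      (L := LinearMap.toSpanSingleton _ _ x₁ ∘ₗ Finsupp.lapply ())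
      (fun b c m hm => hx₁ c m (by simpa using hm))
      (w := fun T => Finsupp.single () (f T)) (p := p) (j := j)
      (fun T b m hm => by simpa using hf T m (by simpa using hm))
    simpa using h1
  have hτker : ∀ f ∈ I, ∃ y, R.d 0 y = f • x₁ := fun f hf => by
    rw [← hker]
    simpa using I.add_mem (hsec f) hf
  constructor
  · intro h f hf hcyc
    have hcycI : ∀ T, koszulD (X (R := k)) f T ∈ I := fun T => (hI _).2 (hcyc T)
    have hD : ∀ T, koszulD (X (R := k)) (fun T => f T • x₁) T =
        koszulD (X (R := k)) f T • x₁ := fun T =>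
      koszulD_map (X (R := k)) (LinearMap.toSpanSingleton _ _ x₁) f T
    obtain ⟨v, hv, hv'⟩ := exists_lift_freeKoszulChains R.coeff_d_single
      (koszulD_mem_freeKoszulChains (hτchain hf)) (fun T => by
        rw [hD]; exact hτker _ (hcycI T))
    obtain ⟨y, hy, z, hz, hyz⟩ := h (fun T => f T • x₁) (hτchain hf)
      ⟨v, hv, (funext hv').symm⟩
    refine ⟨fun T => θ (y T), hθchain hy, fun T m hm => ?_⟩
    rw [← sub_eq_zero, ← coeff_sub]
    refine (hI _).1 ?_ m hm
    have h1 : f T • x₁ = koszulD (X (R := k)) y T + R.d 0 (z T) := congrFun hyz T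
    have h2 : θ (R.d 0 (z T)) ∈ I := (hker _).2 ⟨_, rfl⟩
    have h3 := I.sub_mem h2 (hsec (f T))
    rw [h1, map_add] at h3
    rw [koszulD_map]
    convert h3 using 1
    ring
  · rintro h w hw ⟨v, hv, hwv⟩
    obtain ⟨g, hg, hfg⟩ := h (fun T => θ (w T)) (hθchain hw) (fun T m hm => by
      rw [koszulD_map]
      refine (hI _).1 ((hker _).2 ⟨v T, ?_⟩) m hm
      exact (congrFun hwv T).symm)
    have hD : ∀ T, koszulD (X (R := k)) (fun T => g T • x₁) T =
        koszulD (X (R := k)) g T • x₁ := fun T =>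
      koszulD_map (X (R := k)) (LinearMap.toSpanSingleton _ _ x₁) g T
    obtain ⟨z, hz, hz'⟩ := exists_lift_freeKoszulChains R.coeff_d_single
      (sub_mem hw (koszulD_mem_freeKoszulChains (hτchain hg))) (fun T => by
        rw [← hker, Pi.sub_apply, hD, map_sub]
        have h1 : θ (w T) - koszulD (X (R := k)) g T ∈ I := (hI _).2 fun m hm => by
          rw [coeff_sub, sub_eq_zero]
          exact hfg T m hm
        convert I.sub_mem h1 (hsec (koszulD (X (R := k)) g T)) using 1
        ring)
    refine ⟨_, hτchain hg, z, hz, funext fun T => ?_⟩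
    change w T = koszulD (X (R := k)) (fun T => g T • x₁) T + R.d 0 (z T)
    rw [hz', Pi.sub_apply, add_sub_cancel]

/-- The degrees of the basis elements of a minimal resolution are detected by Koszul homology. -/
theorem exists_deg_eq_iff {P : (σ →₀ ℕ) → Prop}
    (hI : ∀ f : MvPolynomial σ k, f ∈ I ↔ ∀ m, ¬ P m → coeff m f = 0) {i : ℕ} (hi : 0 < i)
    (j : ℕ) : (∃ b, R.deg i b = j) ↔ ¬ MonomialKoszulExact k P i j := by
  obtain ⟨p, rfl⟩ := Nat.exists_eq_succ_of_ne_zero hi.ne'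
  have h := ExactDoubleComplex.vanishesAt_iff (C := R.koszulDoubleComplex j) (p + 1) 0
  rw [add_zero, R.koszulDoubleComplex_vanishesAt_zero_iff,
    R.koszulDoubleComplex_vanishesAt_zero_left_iff hI] at h
  rw [← h]
  push Not
  rfl

end MinimalGradedFreeResolution

/-! ### Existence of minimal graded free resolutions -/

section Existence

open MvPolynomial

variable {σ k : Type*} [Field k]

theorem sum_gradedComponent {ι : Type*} [Fintype ι] (deg : ι → ℕ) (x : ι →₀ MvPolynomial σ k) :
    ∃ M, x = ∑ e ∈ Finset.range M, gradedComponent deg e x := by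
  refine ⟨∑ b, (x b).totalDegree + ∑ b, deg b + 1, finsupp_ext_coeff fun b m => ?_⟩
  rw [Finsupp.finsetSum_apply, coeff_sum]
  simp only [coeff_gradedComponent]
  rw [Finset.sum_ite_eq]
  split_ifs with h
  · rfl
  · by_contra hne
    refine h (Finset.mem_range.2 ?_)
    have h1 : m.degree ≤ (x b).totalDegree := le_totalDegree (mem_support_iff.2 hne)
    have h2 := Finset.single_le_sum (f := fun b => (x b).totalDegree) (fun _ _ => Nat.zero_le _)
      (Finset.mem_univ b)
    have h3 := Finset.single_le_sum (f := deg) (fun _ _ => Nat.zero_le _) (Finset.mem_univ b)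
    omega

variable (σ k) in
/-- A graded submodule, contained in the multiples of the ideal of the variables, of a graded free
module of finite rank. -/
structure SyzygyStage where
  /-- the rank of the free module -/
  rank : ℕ
  /-- the degrees of the basis elements -/
  deg : Fin rank → ℕ
  /-- the graded submodule -/
  submodule : Submodule (MvPolynomial σ k) (Fin rank →₀ MvPolynomial σ k)
  gradedComponent_mem : ∀ e, ∀ x ∈ submodule, gradedComponent deg e x ∈ submodule
  constantCoeff_eq_zero : ∀ x ∈ submodule, ∀ c, constantCoeff (x c) = 0

namespace SyzygyStage

theorem exists_homogeneous_generators [Finite σ] (s : SyzygyStage σ k) :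
    ∃ (n : ℕ) (g : Fin n → Fin s.rank →₀ MvPolynomial σ k) (e : Fin n → ℕ),
      (∀ b, IsHomogeneousVector s.deg (e b) (g b)) ∧
        Submodule.span (MvPolynomial σ k) (Set.range g) = s.submodule := by
  obtain ⟨G, hG⟩ := IsNoetherian.noetherian s.submodule
  choose M hM using sum_gradedComponent (k := k) (σ := σ) s.deg
  let A : Type _ := Σ x : G, Fin (M x)
  obtain ⟨n, ⟨φ⟩⟩ := Finite.exists_equiv_fin A
  refine ⟨n, fun b => gradedComponent s.deg (φ.symm b).2 (φ.symm b).1.1,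
    fun b => (φ.symm b).2, fun b => isHomogeneousVector_gradedComponent _ _ _, ?_⟩
  refine le_antisymm (Submodule.span_le.2 ?_) ?_
  · rintro _ ⟨b, rfl⟩
    refine s.gradedComponent_mem _ _ ?_
    rw [← hG]
    exact Submodule.subset_span (φ.symm b).1.2
  · rw [← hG, Submodule.span_le]
    intro x hx
    rw [SetLike.mem_coe, hM x]
    refine Submodule.sum_mem _ fun e he => Submodule.subset_span ?_
    exact ⟨φ ⟨⟨x, hx⟩, ⟨e, Finset.mem_range.1 he⟩⟩, by dsimp only; rw [Equiv.symm_apply_apply]⟩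

/-- With the least possible number of homogeneous generators, no relation has a nonzero constant
coefficient: it would make one generator redundant. -/
theorem exists_next [Finite σ] (s : SyzygyStage σ k) :
    ∃ (t : SyzygyStage σ k) (L : (Fin t.rank →₀ MvPolynomial σ k) →ₗ[MvPolynomial σ k]
        (Fin s.rank →₀ MvPolynomial σ k)),
      (∀ b c m, coeff m (L (Finsupp.single b 1) c) ≠ 0 → m.degree + s.deg c = t.deg b) ∧
        LinearMap.range L = s.submodule ∧ LinearMap.ker L = t.submodule := by
  classical
  have hex := s.exists_homogeneous_generators
  obtain ⟨g, e, hg, hspan⟩ := Nat.find_spec hex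
  have hmin := fun n => Nat.find_min hex (m := n)
  generalize Nat.find hex = r at g e hg hspan hmin
  set L := Finsupp.linearCombination (MvPolynomial σ k) g with hL
  have hLhom : ∀ b c m, coeff m (L (Finsupp.single b 1) c) ≠ 0 → m.degree + s.deg c = e b := by
    intro b c m hm
    rw [hL, Finsupp.linearCombination_single, one_smul] at hm
    exact hg b c m hm
  refine ⟨⟨r, e, LinearMap.ker L, fun d x hx => ?_, fun x hx b => ?_⟩, L, hLhom, ?_, rfl⟩
  · rw [LinearMap.mem_ker] at hx ⊢
    rw [map_gradedComponent hLhom, hx, gradedComponent_zero]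
  · by_contra hne
    obtain ⟨r, rfl⟩ : ∃ r', r = r' + 1 := ⟨r - 1, by have := b.2; omega⟩
    refine hmin r (Nat.lt_succ_self r) ⟨g ∘ b.succAbove, e ∘ b.succAbove, fun c => hg _, ?_⟩
    rw [← hspan]
    refine le_antisymm (Submodule.span_mono (Set.range_comp_subset_range _ _)) ?_
    rw [Submodule.span_le]
    have hmem : ∀ c, g (b.succAbove c) ∈
        Submodule.span (MvPolynomial σ k) (Set.range (g ∘ b.succAbove)) := fun c =>
      Submodule.subset_span ⟨c, rfl⟩
    rintro _ ⟨c, rfl⟩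
    rcases Fin.eq_self_or_eq_succAbove b c with rfl | ⟨c, rfl⟩
    swap
    · exact hmem c
    -- In this degree the coefficient of `g c` is a nonzero scalar, so the relation can be solved
    -- for `g c`.
    set y := gradedComponent e (e c) x with hy
    have hLy : L y = 0 := by
      rw [hy, map_gradedComponent hLhom, LinearMap.mem_ker.1 hx, gradedComponent_zero]
    have hyc : y c = C (constantCoeff (x c)) := by
      ext m
      rw [hy, coeff_gradedComponent, coeff_C]
      by_cases hm : m = 0
      · subst hm; simp [constantCoeff_eq]
      · rw [if_neg, if_neg (Ne.symm hm)]
        rw [Nat.add_eq_right, Finsupp.degree_eq_zero_iff]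
        exact hm
    rw [hL, Finsupp.linearCombination_apply, Finsupp.sum_fintype _ _ (by simp),
      Fin.sum_univ_succAbove _ c, hyc] at hLy
    have h1 : g c = (C (constantCoeff (x c))⁻¹ : MvPolynomial σ k) •
        -∑ i, y (c.succAbove i) • g (c.succAbove i) := by
      rw [← eq_neg_of_add_eq_zero_left hLy, smul_smul, ← C_mul, inv_mul_cancel₀ hne, C_1, one_smul]
    rw [SetLike.mem_coe, h1]
    exact Submodule.smul_mem _ _ (Submodule.neg_mem _ (Submodule.sum_mem _ fun i _ =>
      Submodule.smul_mem _ _ (hmem i)))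
  · exact (Finsupp.range_linearCombination _).trans hspan

end SyzygyStage

/-- A monomial ideal consisting of polynomials without constant term has a minimal graded free
resolution. -/
theorem MinimalGradedFreeResolution.nonempty_of_monomial [Finite σ]
    {I : Ideal (MvPolynomial σ k)} {P : (σ →₀ ℕ) → Prop}
    (hI : ∀ f : MvPolynomial σ k, f ∈ I ↔ ∀ m, ¬ P m → coeff m f = 0) (hP : ¬ P 0) :
    Nonempty (MinimalGradedFreeResolution I) := by
  choose next L hhom hrange hker using SyzygyStage.exists_next (σ := σ) (k := k)
  let s₀ : SyzygyStage σ k :=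
    { rank := 1
      deg := fun _ => 0
      submodule := Submodule.comap (Finsupp.lapply 0) I
      gradedComponent_mem := fun e x hx => by
        rw [Submodule.mem_comap, Finsupp.lapply_apply, hI] at hx ⊢
        intro m hm
        rw [coeff_gradedComponent, hx m hm, ite_self]
      constantCoeff_eq_zero := fun x hx c => by
        rw [Submodule.mem_comap, Finsupp.lapply_apply, hI] at hx
        rw [Subsingleton.elim c 0]
        exact hx 0 hP }
  let stage : ℕ → SyzygyStage σ k := fun n => Nat.rec s₀ (fun _ s => next s) n
  have hexact : ∀ s, Function.Exact (L (next s)) (L s) := fun s => by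
    rw [LinearMap.exact_iff, hker, hrange]
  exact ⟨{
    ι := fun i => Fin (stage i).rank
    finite := fun i => inferInstance
    deg := fun i => (stage i).deg
    d := fun i => L (stage i)
    ε := Submodule.mkQ I ∘ₗ Finsupp.lapply (0 : Fin 1)
    d_homogeneous := fun i b c m hm => hhom (stage i) b c m (mem_support_iff.1 hm)
    ε_homogeneous := fun b => ⟨1, isHomogeneous_one _ _, by
      have : b = (0 : Fin 1) := Subsingleton.elim (α := Fin 1) _ _
      subst this
      change Submodule.mkQ I (Finsupp.single (0 : Fin 1) (1 : MvPolynomial σ k) 0) = _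
      rw [Finsupp.single_eq_same]
      rfl⟩
    ε_surjective := (Submodule.mkQ_surjective I).comp fun f =>
      ⟨Finsupp.single 0 f, by simp⟩
    exact_zero := by
      rw [LinearMap.exact_iff, LinearMap.ker_comp, Submodule.ker_mkQ]
      exact (hrange s₀).symm
    exact_succ := fun i => hexact (stage i)
    minimal := fun i x c => (stage i).constantCoeff_eq_zero _
      (hrange (stage i) ▸ LinearMap.mem_range_self _ x) c }⟩

end Existence

/-! ### Facets, facet ideals and their Betti numbers -/

namespace PreAbstractSimplicialComplex

open MvPolynomial

section Facets

variable {σ : Type*} {Δ : PreAbstractSimplicialComplex σ}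

theorem nonempty_of_mem_facets {F : Finset σ} (hF : F ∈ Δ.facets) : F.Nonempty :=
  (Δ.isRelLowerSet_faces hF.1).1

theorem eq_of_mem_facets_of_subset {F G : Finset σ} (hF : F ∈ Δ.facets) (hG : G ∈ Δ.facets)
    (h : F ⊆ G) : F = G :=
  Finset.Subset.antisymm h (hF.2 hG.1 h)

theorem facets_generatedBy {A : Set (Finset σ)} (hA : A ⊆ Δ.facets) :
    (generatedBy A).facets = A := by
  ext F
  constructor
  · rintro ⟨⟨hne, G, hG, hFG⟩, hmax⟩
    have h1 : G ∈ (generatedBy A).faces := ⟨nonempty_of_mem_facets (hA hG), G, hG, subset_rfl⟩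
    rwa [Finset.Subset.antisymm hFG (hmax h1 hFG)]
  · intro hF
    refine ⟨⟨nonempty_of_mem_facets (hA hF), F, hF, subset_rfl⟩, ?_⟩
    rintro H ⟨-, G, hG, hHG⟩ hFH
    rwa [eq_of_mem_facets_of_subset (hA hF) (hA hG) (subset_trans hFH hHG)]

theorem facets_inducedSubcollection (Δ : PreAbstractSimplicialComplex σ) (u : Finset σ) :
    (Δ.inducedSubcollection u).facets = {F | F ∈ Δ.facets ∧ F ⊆ u} :=
  facets_generatedBy fun _ hF => hF.1

theorem mem_vertices_inducedSubcollection {u : Finset σ} {v : σ} :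
    v ∈ (Δ.inducedSubcollection u).vertices ↔ ∃ F ∈ Δ.facets, F ⊆ u ∧ v ∈ F := by
  constructor
  · rintro ⟨-, F, hF, hv⟩
    exact ⟨F, hF.1, hF.2, by simpa using hv⟩
  · rintro ⟨F, hF, hFu, hv⟩
    exact ⟨Finset.singleton_nonempty v, F, ⟨hF, hFu⟩, by simpa using hv⟩

theorem mem_vertices_iff [Finite σ] {v : σ} : v ∈ Δ.vertices ↔ ∃ F ∈ Δ.facets, v ∈ F := by
  constructor
  · intro hv
    obtain ⟨F, hle, hF⟩ := (Set.toFinite Δ.faces).exists_le_maximal hv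
    exact ⟨F, hF, by simpa using hle⟩
  · rintro ⟨F, hF, hv⟩
    exact (Δ.isRelLowerSet_faces hF.1).2 (by simpa using hv) (Finset.singleton_nonempty v)

end Facets

section Betti

variable {σ : Type*} [LinearOrder σ] {k : Type*} [Field k]
  {Δ : PreAbstractSimplicialComplex σ}

theorem IsForest.hasLeaves (h : Δ.IsForest) : HasLeaves Δ.facets := by
  intro 𝓖 h𝓖 hne
  have hf := facets_generatedBy h𝓖
  obtain ⟨L, hL, hleaf⟩ := h (generatedBy 𝓖) (by rw [IsSubcollection, hf]; exact h𝓖)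
    (by rwa [hf])
  rw [hf] at hL hleaf
  refine ⟨L, hL, hleaf.imp_right ?_⟩
  rintro ⟨G, hG, hGL, hint⟩
  refine ⟨G, hG, hGL, fun H hH hHL y hy => ?_⟩
  exact_mod_cast hint H hH hHL (by simpa using hy)

theorem mem_facetIdeal_iff {f : MvPolynomial σ k} :
    f ∈ Δ.facetIdeal k ↔ ∀ m, ¬ SquarefreeExponent Δ.facets m → coeff m f = 0 := by
  have h : (fun F : Finset σ => ∏ x ∈ F, (X x : MvPolynomial σ k)) '' Δ.facets =
      (fun s => monomial s (1 : k)) '' (faceExponent '' Δ.facets) := by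
    rw [Set.image_image]
    exact Set.image_congr fun F _ => prod_X_eq_monomial F
  rw [facetIdeal, h, mem_ideal_span_monomial_image]
  simp only [Set.exists_mem_image, faceExponent_le_iff, mem_support_iff, SquarefreeExponent]
  exact forall_congr' fun m => by rw [not_imp_comm]

variable [Fintype σ]

/-- The criterion holds for whichever minimal resolution `gradedBetti` selects. Facets are nonempty,
so a resolution exists and the default value `0` does not occur; finiteness of `ι i` keeps
`Nat.card` from being `0` on an infinite type. -/
theorem betti_ne_zero_iff {i : ℕ} (hi : 0 < i) (j : ℕ) :
    Δ.betti k i j ≠ 0 ↔ ¬ MonomialKoszulExact k (SquarefreeExponent Δ.facets) i j := by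
  have hR : Nonempty (MinimalGradedFreeResolution (Δ.facetIdeal k)) :=
    MinimalGradedFreeResolution.nonempty_of_monomial (fun f => mem_facetIdeal_iff) (by
      rintro ⟨F, hF, hF0⟩
      exact (nonempty_of_mem_facets hF).ne_empty (by simpa using hF0))
  have := hR.some.finite i
  rw [betti, gradedBetti, dif_pos hR, ← hR.some.exists_deg_eq_iff (fun f => mem_facetIdeal_iff) hi,
    ← Nat.pos_iff_ne_zero, Nat.card_pos_iff, nonempty_subtype]
  exact and_iff_left inferInstance

theorem hasKoszulHomology_inducedSubcollection_iff {u : Finset σ} {i : ℕ} :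
    HasKoszulHomology k (Δ.inducedSubcollection u).facets u i ↔
      HasKoszulHomology k Δ.facets u i := by
  rw [HasKoszulHomology, HasKoszulHomology, facets_inducedSubcollection, strand_congr]
  exact fun U hU => ⟨fun ⟨H, hH, hle⟩ => ⟨H, hH.1, hle⟩,
    fun ⟨H, hH, hle⟩ => ⟨H, ⟨hH, hle.trans hU⟩, hle⟩⟩

theorem betti_inducedSubcollection_ne_zero {u : Finset σ} {i : ℕ} (hi : 0 < i)
    (h : HasKoszulHomology k Δ.facets u i) : (Δ.inducedSubcollection u).betti k i u.card ≠ 0 := by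
  rw [betti_ne_zero_iff hi]
  exact (hasKoszulHomology_inducedSubcollection_iff.2 h).not_monomialKoszulExact

theorem vertices_inducedSubcollection_eq {u : Finset σ} {i : ℕ}
    (h : HasKoszulHomology k Δ.facets u i) : (Δ.inducedSubcollection u).vertices = u := by
  ext v
  rw [mem_vertices_inducedSubcollection]
  exact ⟨fun ⟨F, _, hFu, hv⟩ => hFu hv, fun hv => h.exists_mem hv⟩

end Betti

end PreAbstractSimplicialComplex

/-! ### The theorem -/

open PreAbstractSimplicialComplex in
theorem theoremt {σ : Type*} [Finite σ] {k : Type*} [Field k]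
    (Δ : PreAbstractSimplicialComplex σ) (hforest : Δ.IsForest) (hfacets : Δ.facets.Nontrivial)
    (n : ℕ) (hn : Δ.vertices.ncard = n)
    (i a b : ℕ) (hi : i = a + b) (ha : 0 < a) (hb : 0 < b)
    (hβ : Δ.betti k i n ≠ 0) :
    ∃ u w : Finset σ, Δ.AreComplements u w ∧
      (Δ.inducedSubcollection u).betti k a u.card ≠ 0 ∧
      (Δ.inducedSubcollection w).betti k b w.card ≠ 0 := by
  have := Fintype.ofFinite σ
  -- An arbitrary order, used to fix the Koszul signs.
  let _ : LinearOrder σ := LinearOrder.lift' (Fintype.equivFin σ) (Fintype.equivFin σ).injective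
  subst hi hn
  obtain ⟨V, hV⟩ := (Set.toFinite Δ.vertices).exists_finset_coe
  rw [← hV, Set.ncard_coe_finset, betti_ne_zero_iff (Nat.add_pos_left ha b)] at hβ
  have hFV : ∀ F ∈ Δ.facets, F ⊆ V := fun F hF v hv => by
    rw [← Finset.mem_coe, hV]
    exact mem_vertices_iff.2 ⟨F, hF, hv⟩
  obtain ⟨u, w, hunion, hu, hw, hdisj⟩ :=
    (hasKoszulHomology_of_not_monomialKoszulExact hFV hβ).exists_complements a b hforest.hasLeaves
  -- If `s` were all of `V`, a facet inside `t` would lie in `s ∩ t`; so both sets are proper.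
  have hne : ∀ {s t : Finset σ}, s ∪ t = V → t.Nonempty → (∀ H ∈ Δ.facets, ¬ H ⊆ s ∩ t) →
      (∀ x ∈ t, ∃ H ∈ Δ.facets, H ⊆ t ∧ x ∈ H) → (s : Set σ) ⊂ Δ.vertices := by
    rintro s t hst ⟨x, hx⟩ hdis hex
    rw [← hV, Finset.coe_ssubset, ← hst, Finset.ssubset_iff_subset_ne]
    refine ⟨Finset.subset_union_left, fun heq => ?_⟩
    obtain ⟨H, hH, hHt, -⟩ := hex x hx
    refine hdis H hH (Finset.subset_inter (hHt.trans ?_) hHt)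
    rw [heq]
    exact Finset.subset_union_right
  refine ⟨u, w, ⟨⟨vertices_inducedSubcollection_eq hu, hu.nonempty ha, ?_⟩,
    ⟨vertices_inducedSubcollection_eq hw, hw.nonempty hb, ?_⟩, ?_, ?_⟩,
    betti_inducedSubcollection_ne_zero ha hu, betti_inducedSubcollection_ne_zero hb hw⟩
  · exact hne hunion (hw.nonempty hb) hdisj (fun x hx => hw.exists_mem hx)
  · exact hne (Finset.union_comm w u ▸ hunion) (hu.nonempty ha)
      (fun H hH hle => hdisj H hH (Finset.inter_comm w u ▸ hle)) (fun x hx => hu.exists_mem hx)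
  · rw [← Finset.coe_union, hunion, hV]
  · rw [facets_inducedSubcollection, facets_inducedSubcollection]
    exact Set.disjoint_left.2 fun H h1 h2 => hdisj H h1.1 (Finset.subset_inter h1.2 h2.2)
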